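/- **Setting.** Let $k\ge 1$ be an integer. A *typed $k$-strict partition* is an integer partition $\lambda=(\lambda_1\ge\dots\ge\lambda_\ell>0)$ in which no part greater than $k$ is repeated, together with an integer $\mathrm{type}(\lambda)\in\{0,1,2\}$ that is positive if and only if some part of $\lambda$ equals $k$. Put $|\lambda|=\sum_i\lambda_i$, let $\ell_k(\lambda)$ be the number of parts greater than $k$, and $m=\ell_k(\lambda)+1$. Let $\widetilde W_\infty$ be the group of signed permutations $w=(w_1,w_2,\dots)$ of the positive integers with $w_i=i$ for almost all $i$ and an even number of negative entries. To $\lambda$ corresponds the element $w\in\widetilde W_\infty$ with $|w_1|<w_2<\dots<w_k$ and $w_{k+1}<w_{k+2}<\cdots$ such that, for all $j\ge1$, $\lambda_j=k-1+|w_{k+j}|$ if $w_{k+j}<0$ and $\lambda_j=\#\{p\le k:|w_p|>w_{k+j}\}$ if $w_{k+j}>0$, while $\mathrm{type}(\lambda)=0$ if $|w_1|=1$, and otherwise $\mathrm{type}(\lambda)$ is $1$ or $2$ according as $w_1>0$ or $w_1<0$. Put $\mathcal C(\lambda)=\{(i,j):1\le i<j,\ w_{k+i}+w_{k+j}<0\}$,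 and $\beta_j(\lambda)=w_{k+j}+1$ if $w_{k+j}<0$, $\beta_j(\lambda)=w_{k+j}$ if $w_{k+j}>0$. Let $\mathbb Z[b]=\mathbb Z[\tilde b_k,b_1,b_2,\dots]$, $b_0=1$, $b_p=0$ for $p<0$, and $c_p=b_p$ for $p<k$, $c_k=b_k+\tilde b_k$, $c_p=2b_p$ for $p>k$. Let $J^{(k)}\subset\mathbb Z[b]$ be the ideal generated by $b_p^2+\sum_{i=1}^p(-1)^ib_{p+i}c_{p-i}$ for $p>k$ and $b_k\tilde b_k+\sum_{i=1}^k(-1)^ib_{k+i}b_{k-i}$. Put $B^{(k)}=\mathbb Z[b]/J^{(k)}$, $t=(t_1,t_2,\dots)$. For $r\ge0$ let $e^r_j(-t)$ and $h^r_j(-t)$ be the elementary and complete symmetric polynomials of degree $j$ in $-t_1,\dots,-t_r$; for $r<0$ put $h^r_j=e^{-r}_j$. For $p,r\in\mathbb Z$ and $s\in\{0,1\}$ put $$c^r_p=\sum_{j=0}^pc_{p-j}h^r_j(-t),\quad a^s_p=\tfrac12c_p+\sum_{j=1}^pc_{p-j}h^s_j(-t),\quad b^s_k=b_k+\sum_{j=1}^kc_{k-j}h^s_j(-t),\quad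 \tilde b^s_k=\tilde b_k+\sum_{j=1}^kc_{k-j}h^s_j(-t).$$ At position $i$, let $\hat c^{\,r}_p=c^r_p$ unless $r=k-p<0$, in which case $\hat c^{\,r}_p=c^r_p+(2\tilde b_k-c_k)\,e^{p-k}_{p-k}(-t)$ for $i$ odd and $\hat c^{\,r}_p=c^r_p+(2b_k-c_k)\,e^{p-k}_{p-k}(-t)$ for $i$ even. **Eta polynomials.** For $i<j$ let $R_{ij}$ raise the $i$-th entry of an integer sequence by $1$ and lower the $j$-th entry by $1$. Expand $R^\lambda=\prod_{i<j}(1-R_{ij})\prod_{(i,j)\in\mathcal C(\lambda)}(1+R_{ij})^{-1}$ as a series in the monomials $R=\prod_{i<j\le\ell}R_{ij}^{n_{ij}}$ (monomials involving an index $>\ell$ contribute $0$). For such $R$ put $\nu=R\lambda$, $\beta=\beta(\lambda)$, and let $\bar c_i=c^{\beta_i}_{\nu_i}$ if $i$ is one of the indices of some $R_{pq}$ with $n_{pq}>0$ and $q<m$, and $\bar c_i=\hat c^{\,\beta_i}_{\nu_i}$ (at position $i$) otherwise. If $\mathrm{type}(\lambda)=0$, let $R\star\hat c^\beta_\lambda=\bar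 c_1\cdots\bar c_\ell$. If $\mathrm{type}(\lambda)>0$, let $R\star\hat c^\beta_\lambda=\bar c_1\cdots\bar c_{m-1}\cdot x\cdot c^{\beta_{m+1}}_{\nu_{m+1}}\cdots c^{\beta_\ell}_{\nu_\ell}$, where $x=a^{\beta_m}_{\nu_m}$ if $R$ involves some $R_{ij}$ with $i=m$ or $j=m$, and otherwise $x=b^{\beta_m}_k$ for type $1$ and $x=\tilde b^{\beta_m}_k$ for type $2$. The *double eta polynomial* is $H_\lambda(c\,|\,t)=2^{-\ell_k(\lambda)}R^\lambda\star\hat c^{\beta(\lambda)}_\lambda$, extended linearly over the expansion of $R^\lambda$, and the *single eta polynomial* is $H_\lambda(c)=H_\lambda(c\,|\,0)$. Finally let $b_\lambda=2^{-\ell_k(\lambda)}c_\lambda$, where $c_\lambda=c_{\lambda_1}\cdots c_{\lambda_\ell}$, except that the factor with index $m$ is replaced by $b_k$ if $\mathrm{type}(\lambda)=1$ and by $\tilde b_k$ if $\mathrm{type}(\lambda)=2$. **Proposition.** The $b_\lambda$ and $H_\lambda(c)$ lie in $\mathbb Z[b]$ and the $H_\lambda(c\,|\,t)$ lie in $\mathbb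 Z[b,t]$. As $\lambda$ runs over all typed $k$-strict partitions, the classes of the monomials $b_\lambda$, of the single eta polynomials $H_\lambda(c)$, and of the double eta polynomials $H_\lambda(c\,|\,t)$ form three $\mathbb Z[t]$-bases of $B^{(k)}[t]$. Moreover, for every $\lambda$ one has in $B^{(k)}[t]$ an expansion $$H_\lambda(c\,|\,t)=b_\lambda+\sum_\mu a_{\lambda\mu}\,b_\mu,\qquad a_{\lambda\mu}\in\mathbb Z[t],$$ a finite sum over typed $k$-strict partitions $\mu$ such that either $|\mu|<|\lambda|$, or $|\mu|=|\lambda|$, $\mu\ne\lambda$ as partitions, and $\mu_1+\dots+\mu_n\ge\lambda_1+\dots+\lambda_n$ for all $n$. -/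

import Mathlib

open MvPolynomial

/-! ### Typed `k`-strict partitions

Positions are counted from `0`: `part j` is the `(j+1)`-st part. -/

/-- A typed `k`-strict partition: a weakly decreasing list of positive parts, in which no part
greater than `k` is repeated, together with a type in `{0, 1, 2}` which is positive if and only if
some part equals `k`. -/
@[ext]
structure TypedPartition (k : ℕ) where
  parts : List ℕ
  sorted : parts.Pairwise (fun a b => b ≤ a)
  pos : ∀ p ∈ parts, 0 < p
  strict : ∀ p, k < p → parts.count p ≤ 1
  type : ℕ
  type_le : type ≤ 2
  type_pos_iff : 0 < type ↔ k ∈ parts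

namespace TypedPartition

variable {k : ℕ}

/-- The parts as a sequence, extended by zeros. -/
def part (lam : TypedPartition k) (j : ℕ) : ℕ := lam.parts.getD j 0

/-- The length `ℓ`. -/
def length (lam : TypedPartition k) : ℕ := lam.parts.length

/-- The size `|λ|`. -/
def size (lam : TypedPartition k) : ℕ := lam.parts.sum

/-- The number `ℓ_k(λ)` of parts strictly greater than `k`.  Counting from `0`, it is also the
position of the part with index `m = ℓ_k(λ) + 1`. -/
def numLarge (lam : TypedPartition k) : ℕ := lam.parts.countP (fun p => k < p)

/-- `mu` strictly dominates `lam`: the shapes have equal size, are different, and each partial sum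
of the parts of `mu` is at least the corresponding one of `lam`. -/
def StrictlyDominates (mu lam : TypedPartition k) : Prop :=
  mu.size = lam.size ∧ mu.parts ≠ lam.parts ∧
    ∀ n, ∑ j ∈ Finset.range n, lam.part j ≤ ∑ j ∈ Finset.range n, mu.part j

end TypedPartition

/-! ### Grassmannian elements

An element of the infinite Weyl group of type D is a sequence `w : ℕ → ℤ` with
`w i = w_{i+1}`, a negative value standing for a barred entry. -/

/-- Signed permutations of the positive integers that fix almost every point and have an even
number of sign changes. -/
structure IsEvenSignedPerm (w : ℕ → ℤ) : Prop where
  bijOn : Set.BijOn (fun i => (w i).natAbs) Set.univ {m | 0 < m}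
  eventually_fixed : ∃ n, ∀ i, n ≤ i → w i = i + 1
  even_signs : Even (Set.ncard {i | w i < 0})

/-- `|w_1| < w_2 < ... < w_k` and `w_{k+1} < w_{k+2} < ...`. -/
structure IsGrassmannian (k : ℕ) (w : ℕ → ℤ) : Prop extends IsEvenSignedPerm w where
  first_lt : ∀ i, i + 1 < k → |w i| < w (i + 1)
  second_lt : ∀ j, w (k + j) < w (k + j + 1)

/-- The `k`-Grassmannian element `w` corresponds to the typed `k`-strict partition `lam`. -/
structure Corresponds (k : ℕ) (w : ℕ → ℤ) (lam : TypedPartition k) : Prop where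
  grassmannian : IsGrassmannian k w
  part_eq : ∀ j, (lam.part j : ℤ) =
    if w (k + j) < 0 then (k : ℤ) - 1 + |w (k + j)|
    else (((Finset.range k).filter (fun p => w (k + j) < |w p|)).card : ℤ)
  type_eq : lam.type = if |w 0| ≤ 1 then 0 else if 0 < w 0 then 1 else 2

/-- A `0`-`1` lattice path: the complement of the set of values of `j ↦ j + (k - μ j)`. -/
theorem exists_complementary_seq (k : ℕ) (μ : ℕ → ℕ) (hμ : Antitone μ) (hle : ∀ j, μ j ≤ k)
    (hev : ∃ n, μ n = 0) :
    ∃ g : ℕ → ℕ,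
      (∀ p j, p < k → k ≤ μ j + p → j + (k - μ j) < g p) ∧
      (∀ p j, p < k → μ j + p < k → g p < j + (k - μ j)) ∧
      (∀ p q, p < q → q < k → g p < g q) ∧
      (∀ y, (∃ j, j + (k - μ j) = y) ∨ ∃ p, p < k ∧ g p = y) ∧
      (0 < k → μ 0 < k → g 0 = 0) := by
  classical
  have hex : ∀ p, p < k → ∃ j, μ j + p < k := by
    intro p hp
    obtain ⟨n, hn⟩ := hev
    exact ⟨n, by omega⟩
  have hmc : ∃ mc : ℕ → ℕ, ∀ p, p < k → ∀ j, j < mc p ↔ k ≤ μ j + p := by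
    refine ⟨fun p => if hp : p < k then Nat.find (hex p hp) else 0, fun p hp j => ?_⟩
    simp only [hp, dif_pos, Nat.lt_find_iff]
    constructor
    · intro h
      have := h j le_rfl
      omega
    · intro h m hm
      have := hμ hm
      omega
  obtain ⟨mc, hmc⟩ := hmc
  refine ⟨fun p => p + mc p, ?_, ?_, ?_, ?_, ?_⟩
  · intro p j hp h
    have := (hmc p hp j).2 h
    show j + (k - μ j) < p + mc p
    omega
  · intro p j hp h
    have : ¬ j < mc p := fun h' => by have := (hmc p hp j).1 h'; omega
    show p + mc p < j + (k - μ j)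
    omega
  · intro p q hpq hq
    have : mc p ≤ mc q := by
      by_contra hcon
      push Not at hcon
      have h1 := (hmc p (by omega) (mc q)).1 hcon
      have h2 := (hmc q hq (mc q)).2 (by omega)
      omega
    show p + mc p < q + mc q
    omega
  · intro y
    have hE : ∃ j, y ≤ j + (k - μ j) := ⟨y, by omega⟩
    set j := Nat.find hE with hj
    have h1 : y ≤ j + (k - μ j) := Nat.find_spec hE
    rcases h1.eq_or_lt with h1 | h1
    · exact Or.inl ⟨j, h1.symm⟩
    right
    have hmin : ∀ i, i < j → i + (k - μ i) < y := fun i hi => by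
      have := Nat.find_min hE hi
      omega
    have hjy : j ≤ y := by
      by_contra hcon
      push Not at hcon
      have := hmin (j - 1) (by omega)
      omega
    have hlt : y - j < k := by omega
    refine ⟨y - j, hlt, ?_⟩
    have hm : mc (y - j) = j := by
      apply le_antisymm
      · by_contra hcon
        push Not at hcon
        have := (hmc _ hlt j).1 hcon
        omega
      · by_contra hcon
        push Not at hcon
        have h2 := hmin (j - 1) (by omega)
        have h3 : j - 1 < mc (y - j) := (hmc _ hlt _).2 (by have := hle (j-1); omega)
        omega
    show y - j + mc (y - j) = y
    omega
  · intro hk h0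
    have : ¬ 0 < mc 0 := fun h => by have := (hmc 0 hk 0).1 h; omega
    show 0 + mc 0 = 0
    omega

theorem List.lt_getD_iff_lt_countP (k : ℕ) (l : List ℕ)
    (h : l.Pairwise (fun a b => b ≤ a)) (j : ℕ) :
    k < l.getD j 0 ↔ j < l.countP (fun p => k < p) := by
  induction l generalizing j with
  | nil => simp
  | cons a l ih =>
    rw [List.pairwise_cons] at h
    by_cases ha : k < a
    · cases j with
      | zero => simp [ha]
      | succ j => simpa [ha] using ih h.2 j
    · have h0 : l.countP (fun p => k < p) = 0 := by
        rw [List.countP_eq_zero]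
        intro b hb
        have := h.1 b hb
        simp; omega
      cases j with
      | zero => simp [ha, h0]
      | succ j =>
        have := ih h.2 j
        simp [ha, h0] at this ⊢
        omega

namespace TypedPartition

variable {k : ℕ}

theorem lt_part_iff (lam : TypedPartition k) (j : ℕ) : k < lam.part j ↔ j < lam.numLarge :=
  List.lt_getD_iff_lt_countP k lam.parts lam.sorted j

theorem part_antitone (lam : TypedPartition k) : Antitone lam.part := by
  intro i j hij
  rcases hij.eq_or_lt with rfl | hij
  · rfl
  unfold part
  by_cases hj : j < lam.parts.length
  · rw [List.getD_eq_getElem _ _ hj, List.getD_eq_getElem _ _ (hij.trans hj)]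
    exact List.pairwise_iff_getElem.1 lam.sorted i j _ _ hij
  · rw [List.getD_eq_default _ _ (by omega)]
    exact Nat.zero_le _

theorem part_strict (lam : TypedPartition k) {i j : ℕ} (hij : i < j) (hj : k < lam.part j) :
    lam.part j < lam.part i := by
  refine lt_of_le_of_ne (lam.part_antitone hij.le) fun heq => ?_
  have hjl : j < lam.parts.length := by
    by_contra hcon
    unfold part at hj
    rw [List.getD_eq_default _ _ (by omega)] at hj
    omega
  have h1 := lam.strict _ hj
  have h2 : ∀ (l : List ℕ) (i j : ℕ) (hij : i < j) (hjl : j < l.length), l[i] = l[j] →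
      2 ≤ l.count l[j] := by
    intro l i j hij hjl he
    have hd : List.Duplicate l[j] l := by
      rw [List.duplicate_iff_exists_distinct_get]
      exact ⟨⟨i, hij.trans hjl⟩, ⟨j, hjl⟩, hij, he.symm, rfl⟩
    exact List.duplicate_iff_two_le_count.1 hd
  unfold part at heq h1
  rw [List.getD_eq_getElem _ _ hjl] at heq h1
  rw [List.getD_eq_getElem _ _ (hij.trans hjl)] at heq
  have := h2 lam.parts i j hij hjl heq.symm
  omega

theorem mem_parts_iff (lam : TypedPartition k) (hk : 0 < k) :
    k ∈ lam.parts ↔ lam.part lam.numLarge = k := by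
  constructor
  · intro h
    obtain ⟨i, hi, he⟩ := List.mem_iff_getElem.1 h
    have hp : lam.part i = k := by
      unfold part
      rw [List.getD_eq_getElem _ _ hi, he]
    have h1 : ¬ i < lam.numLarge := fun h' => by
      have := (lam.lt_part_iff i).2 h'
      omega
    have h2 : ¬ k < lam.part lam.numLarge := fun h' => by
      have := (lam.lt_part_iff _).1 h'
      omega
    have := lam.part_antitone (not_lt.1 h1)
    omega
  · intro h
    have hjl : lam.numLarge < lam.parts.length := by
      by_contra hcon
      unfold part at h
      rw [List.getD_eq_default _ _ (by omega)] at h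
      omega
    unfold part at h
    rw [List.getD_eq_getElem _ _ hjl] at h
    exact List.mem_iff_getElem.2 ⟨_, hjl, h⟩

end TypedPartition

set_option maxHeartbeats 800000 in
/-- Every typed `k`-strict partition comes from a `k`-Grassmannian element. -/
theorem exists_corresponds {k : ℕ} (hk : 0 < k) (lam : TypedPartition k) :
    ∃ w, Corresponds k w lam := by
  classical
  set L := lam.numLarge with hL
  have hbig : ∀ j, k < lam.part j ↔ j < L := lam.lt_part_iff
  set N : Finset ℕ := (Finset.range L).image (fun j => lam.part j - k + 1) with hN
  have hNcard : N.card = L := by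
    rw [hN, Finset.card_image_of_injOn, Finset.card_range]
    intro i hi j hj hij
    simp only [Finset.coe_range, Set.mem_Iio] at hi hj
    have h1 := (hbig i).2 hi
    have h2 := (hbig j).2 hj
    rcases lt_trichotomy i j with h | h | h
    · have := lam.part_strict h h2
      simp only at hij
      omega
    · exact h
    · have := lam.part_strict h h1
      simp only at hij
      omega
  have hNmem : ∀ n, n ∈ N ↔ ∃ j, j < L ∧ lam.part j - k + 1 = n := by
    intro n; simp [hN]
  have hN2 : ∀ n ∈ N, 2 ≤ n := by
    intro n hn
    obtain ⟨j, hj, rfl⟩ := (hNmem n).1 hn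
    have := (hbig j).2 hj
    omega
  set P : ℕ → Prop := fun n => 0 < n ∧ n ∉ N with hP
  have hPinf : {n | P n}.Infinite := by
    have : {n | P n} = Set.univ \ (↑(insert 0 N) : Set ℕ) := by
      ext n; simp [hP, Nat.pos_iff_ne_zero]
    rw [this]
    exact Set.infinite_univ.sdiff (Finset.finite_toSet _)
  set x := Nat.nth P with hx
  have hxm : StrictMono x := Nat.nth_strictMono hPinf
  have hxP : ∀ n, P (x n) := Nat.nth_mem_of_infinite hPinf
  have hxr : ∀ m, P m → ∃ n, x n = m := by
    intro m hm
    exact ⟨Nat.count P m, Nat.nth_count hm⟩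
  have hx0 : x 0 = 1 := by
    have hP1 : P 1 := ⟨one_pos, fun h => by have := hN2 1 h; omega⟩
    obtain ⟨n, hn⟩ := hxr 1 hP1
    have h1 := (hxP 0).1
    have h2 := hxm.monotone (Nat.zero_le n)
    omega
  have hxev : ∃ n0, ∀ n, n0 ≤ n → x n = n + 1 + L := by
    obtain ⟨B, hB⟩ : ∃ B, ∀ n ∈ N, n < B := ⟨N.sup id + 1, fun n hn => by
      have := Finset.le_sup (f := id) hn
      simp at this; omega⟩
    refine ⟨B, fun n hn => ?_⟩
    have hPm : P (n + 1 + L) := ⟨by omega, fun h => by have := hB _ h; omega⟩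
    have hc : Nat.count P (n + 1 + L) = n := by
      rw [Nat.count_eq_card_filter_range]
      have : (Finset.range (n + 1 + L)).filter P = Finset.range (n + 1 + L) \ insert 0 N := by
        ext m; simp [hP, Nat.pos_iff_ne_zero]
      rw [this, Finset.card_sdiff_of_subset, Finset.card_range, Finset.card_insert_of_notMem, hNcard]
      · omega
      · intro h; have := hN2 0 h; omega
      · intro m hm
        rw [Finset.mem_insert] at hm
        rw [Finset.mem_range]
        rcases hm with rfl | hm
        · omega
        · have := hB m hm; omega
    have h := Nat.nth_count hPm
    rw [hc] at h
    exact h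
  set μ : ℕ → ℕ := fun j => lam.part (L + j) with hμ
  have hμa : Antitone μ := fun i j hij => lam.part_antitone (by omega)
  have hμk : ∀ j, μ j ≤ k := by
    intro j
    by_contra hcon
    push Not at hcon
    have := (hbig (L + j)).1 hcon
    omega
  have hμ0 : ∀ n, lam.parts.length ≤ n → μ n = 0 := fun n hn => by
    simp only [hμ, TypedPartition.part]
    exact List.getD_eq_default _ _ (by omega)
  obtain ⟨g, hg1, hg2, hg3, hg4, hg5⟩ := exists_complementary_seq k μ hμa hμk ⟨_, hμ0 _ le_rfl⟩
  have htype : 0 < lam.type ↔ μ 0 = k := by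
    rw [lam.type_pos_iff, lam.mem_parts_iff hk]
    simp [hμ, hL]
  set f : ℕ → ℕ := fun j => j + (k - μ j) with hf
  have hfm : ∀ i j, i < j → f i < f j := fun i j hij => by
    have := hμa hij.le
    simp only [hf]; omega
  have hfi : ∀ i j, f i = f j → i = j := fun i j h => by
    rcases lt_trichotomy i j with h' | h' | h'
    · have := hfm _ _ h'; omega
    · exact h'
    · have := hfm _ _ h'; omega
  have hgi : ∀ p q, p < k → q < k → g p = g q → p = q := fun p q hp hq h => by
    rcases lt_trichotomy p q with h' | h' | h'
    · have := hg3 _ _ h' hq; omega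
    · exact h'
    · have := hg3 _ _ h' hp; omega
  have hgf : ∀ p j, p < k → g p ≠ f j := fun p j hp h => by
    simp only [hf] at h
    rcases le_or_gt k (μ j + p) with h' | h'
    · have := hg1 p j hp h'; omega
    · have := hg2 p j hp h'; omega
  -- the absolute values
  set u : ℕ → ℕ := fun i =>
    if i < k then x (g i) else if i < k + L then lam.part (i - k) - k + 1 else x (f (i - k - L))
    with hu
  have hu1 : ∀ i, i < k → u i = x (g i) := fun i hi => by simp [hu, hi]
  have hu2 : ∀ j, j < L → u (k + j) = lam.part j - k + 1 := fun j hj => by simp [hu, hj]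
  have hu3 : ∀ j, u (k + L + j) = x (f j) := fun j => by
    simp only [hu]
    rw [if_neg (by omega), if_neg (by omega)]
    congr 2; omega
  have hcase : ∀ i, i < k ∨ (∃ j, j < L ∧ i = k + j) ∨ ∃ j, i = k + L + j := by
    intro i
    rcases lt_or_ge i k with h | h
    · exact Or.inl h
    rcases lt_or_ge i (k + L) with h' | h'
    · exact Or.inr (Or.inl ⟨i - k, by omega, by omega⟩)
    · exact Or.inr (Or.inr ⟨i - k - L, by omega⟩)
  have hupos : ∀ i, 0 < u i := by
    intro i
    rcases hcase i with h | ⟨j, hj, rfl⟩ | ⟨j, rfl⟩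
    · rw [hu1 i h]; exact (hxP _).1
    · rw [hu2 j hj]; omega
    · rw [hu3 j]; exact (hxP _).1
  have huN : ∀ j, j < L → u (k + j) ∈ N := fun j hj => by
    rw [hu2 j hj, hNmem]; exact ⟨j, hj, rfl⟩
  have huN1 : ∀ i, i < k → u i ∉ N := fun i hi => by rw [hu1 i hi]; exact (hxP _).2
  have huN3 : ∀ j, u (k + L + j) ∉ N := fun j => by rw [hu3 j]; exact (hxP _).2
  have huinj : Function.Injective u := by
    intro a b hab
    rcases hcase a with ha | ⟨i, hi, rfl⟩ | ⟨i, rfl⟩ <;>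
    rcases hcase b with hb | ⟨j, hj, rfl⟩ | ⟨j, rfl⟩
    · rw [hu1 a ha, hu1 b hb] at hab
      exact hgi a b ha hb (hxm.injective hab)
    · exact absurd (hab ▸ huN j hj) (huN1 a ha)
    · rw [hu1 a ha, hu3 j] at hab
      exact absurd (hxm.injective hab) (hgf a j ha)
    · exact absurd (hab ▸ huN i hi) (huN1 b hb)
    · rw [hu2 i hi, hu2 j hj] at hab
      have h1 := (hbig i).2 hi
      have h2 := (hbig j).2 hj
      rcases lt_trichotomy i j with h | h | h
      · have := lam.part_strict h h2; omega
      · rw [h]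
      · have := lam.part_strict h h1; omega
    · exact absurd (hab ▸ huN i hi) (huN3 j)
    · rw [hu1 b hb, hu3 i] at hab
      exact absurd (hxm.injective hab).symm (hgf b i hb)
    · exact absurd (hab ▸ huN j hj) (huN3 i)
    · rw [hu3 i, hu3 j] at hab
      rw [hfi i j (hxm.injective hab)]
  have husurj : ∀ m, 0 < m → ∃ i, u i = m := by
    intro m hm
    by_cases hmN : m ∈ N
    · obtain ⟨j, hj, rfl⟩ := (hNmem m).1 hmN
      exact ⟨k + j, hu2 j hj⟩
    · obtain ⟨n, rfl⟩ := hxr m ⟨hm, hmN⟩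
      rcases hg4 n with ⟨j, rfl⟩ | ⟨p, hp, rfl⟩
      · exact ⟨k + L + j, hu3 j⟩
      · exact ⟨p, hu1 p hp⟩
  -- the set of sign changes
  set c0 : Prop := lam.type = 2 ∨ (lam.type = 0 ∧ Odd L) with hc0
  set c1 : Prop := (lam.type = 1 ∧ Odd L) ∨ (lam.type = 2 ∧ Even L) with hc1
  set S : Finset ℕ := Finset.Ico k (k + L) ∪
    ((if c0 then {0} else ∅) ∪ (if c1 then {k + L} else ∅)) with hS
  have hS0 : ∀ i, i < k → (i ∈ S ↔ i = 0 ∧ c0) := by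
    intro i hi
    by_cases h0 : c0 <;> by_cases h1 : c1 <;> simp [hS, h0, h1] <;> omega
  have hS2 : ∀ j, j < L → k + j ∈ S := by
    intro j hj
    simp [hS, hj]
  have hS3 : ∀ j, k + L + j ∈ S ↔ j = 0 ∧ c1 := by
    intro j
    by_cases h0 : c0 <;> by_cases h1 : c1 <;> simp [hS, h0, h1] <;> omega
  have hScard : Even S.card := by
    have hd : S.card = L + ((if c0 then 1 else 0) + (if c1 then 1 else 0)) := by
      rw [hS, Finset.card_union_of_disjoint, Finset.card_union_of_disjoint, Nat.card_Ico]
      · split_ifs <;> simp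
      · split_ifs <;> simp; omega
      · split_ifs <;> simp <;> omega
    rw [hd]
    have ht' : lam.type = 0 ∨ lam.type = 1 ∨ lam.type = 2 := by
      have := lam.type_le
      omega
    rcases Nat.even_or_odd L with hLe | hLo
    · have hLo : ¬ Odd L := Nat.not_odd_iff_even.2 hLe
      rcases ht' with h | h | h <;> simp [hc0, hc1, h, hLe, hLo, Nat.even_add]
    · have hLe : ¬ Even L := Nat.not_even_iff_odd.2 hLo
      rcases ht' with h | h | h <;> simp [hc0, hc1, h, hLe, hLo, Nat.even_add]
  set w : ℕ → ℤ := fun i => if i ∈ S then -(u i : ℤ) else u i with hw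
  have hwabs : ∀ i, |w i| = u i := by
    intro i
    simp only [hw]
    split_ifs <;> simp
  have hwneg : ∀ i, w i < 0 ↔ i ∈ S := by
    intro i
    have := hupos i
    simp only [hw]
    split_ifs with h <;> simp [h]
    omega
  have hwS : ∀ i, i ∈ S → w i = -(u i : ℤ) := fun i h => by simp [hw, h]
  have hwnS : ∀ i, i ∉ S → w i = (u i : ℤ) := fun i h => by simp [hw, h]
  have hnat : (fun i => (w i).natAbs) = u := by
    funext i
    have := hwabs i
    rw [Int.abs_eq_natAbs] at this
    exact_mod_cast this
  have huc1 : c1 → u (k + L) = 1 := by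
    intro h
    have : 0 < lam.type := by rcases h with h | h <;> omega
    have hm := htype.1 this
    have h3 := hu3 0
    rw [Nat.add_zero] at h3
    rw [h3, show f 0 = 0 by simp [hf, hm], hx0]
  refine ⟨w, ⟨⟨⟨?_, ?_, ?_⟩, ?_, ?_⟩, ?_, ?_⟩⟩
  · rw [hnat]
    exact ⟨fun i _ => hupos i, huinj.injOn, fun m hm => by
      obtain ⟨i, hi⟩ := husurj m hm
      exact ⟨i, trivial, hi⟩⟩
  · obtain ⟨n0, hn0⟩ := hxev
    refine ⟨k + L + (1 + n0 + lam.parts.length), fun i hi => ?_⟩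
    obtain ⟨j, rfl⟩ : ∃ j, i = k + L + j := ⟨i - k - L, by omega⟩
    rw [hwnS, hu3, hn0]
    · have := hμ0 j (by omega)
      simp only [hf, this]; push_cast; omega
    · simp only [hf]; omega
    · rw [hS3]; omega
  · have : {i | w i < 0} = (S : Set ℕ) := by ext i; simp [hwneg]
    rw [this, Set.ncard_coe_finset]
    exact hScard
  · intro i hi
    rw [hwabs, hwnS (i + 1) (by rw [hS0 _ hi]; omega), hu1 i (by omega), hu1 _ hi]
    exact_mod_cast hxm (hg3 i (i + 1) (by omega) hi)
  · intro j
    rcases lt_trichotomy (j + 1) L with h | h | h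
    · rw [hwS _ (hS2 j (by omega)), add_assoc, hwS _ (hS2 (j + 1) h), hu2 _ h, hu2 _ (by omega)]
      have := lam.part_strict (Nat.lt_add_one j) ((hbig (j + 1)).2 h)
      have := (hbig (j + 1)).2 h
      omega
    · have h1 : w (k + j) ≤ -2 := by
        rw [hwS _ (hS2 j (by omega))]
        have := hN2 _ (huN j (by omega))
        omega
      have h2 : -1 ≤ w (k + j + 1) := by
        rw [show k + j + 1 = k + L by omega]
        by_cases hc : c1
        · rw [hwS (k + L) ((hS3 0).2 ⟨rfl, hc⟩), huc1 hc]; simp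
        · rw [hwnS (k + L) (fun h' => hc ((hS3 0).1 h').2)]
          omega
      omega
    · obtain ⟨i, rfl⟩ : ∃ i, j = L + i := ⟨j - L, by omega⟩
      have h1 : w (k + (L + i)) ≤ u (k + L + i) := by
        rw [← add_assoc, ← hwabs]; exact le_abs_self _
      have h2 : w (k + (L + i) + 1) = u (k + L + (i + 1)) := by
        rw [show k + (L + i) + 1 = k + L + (i + 1) by omega]
        exact hwnS _ (by rw [hS3]; omega)
      rw [h2]
      refine h1.trans_lt ?_
      rw [hu3, hu3]
      exact_mod_cast hxm (hfm i (i + 1) (by omega))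
  · intro j
    split_ifs with h
    · rw [hwabs]
      rw [hwneg] at h
      rcases lt_or_ge j L with hj | hj
      · rw [hu2 j hj]
        have := (hbig j).2 hj
        push_cast [Nat.cast_sub this.le]
        ring
      · obtain ⟨i, rfl⟩ : ∃ i, j = L + i := ⟨j - L, by omega⟩
        rw [← add_assoc, hS3] at h
        obtain ⟨rfl, hc⟩ := h
        rw [Nat.add_zero, huc1 hc]
        have hm := htype.1 (by rcases hc with h | h <;> omega)
        simp only [hμ, Nat.add_zero] at hm
        rw [hm]; push_cast; ring
    · rw [hwneg] at h
      rcases lt_or_ge j L with hj | hj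
      · exact absurd (hS2 j hj) h
      obtain ⟨i, rfl⟩ : ∃ i, j = L + i := ⟨j - L, by omega⟩
      have : (Finset.range k).filter (fun p => w (k + (L + i)) < |w p|) =
          Finset.Ico (k - μ i) k := by
        ext p
        rw [Finset.mem_filter, Finset.mem_range, Finset.mem_Ico, hwabs, hwnS _ h, ← add_assoc, hu3]
        constructor
        · rintro ⟨hp, hlt⟩
          refine ⟨?_, hp⟩
          rw [hu1 p hp] at hlt
          have hlt' : f i < g p := hxm.lt_iff_lt.1 (by exact_mod_cast hlt)
          by_contra hcon
          have := hg2 p i hp (by omega)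
          simp only [hf] at hlt'
          omega
        · rintro ⟨h1, hp⟩
          refine ⟨hp, ?_⟩
          rw [hu1 p hp]
          have := hg1 p i hp (by omega)
          exact_mod_cast hxm this
      rw [this, Nat.card_Ico]
      have := hμk i
      have hmi : lam.part (L + i) = μ i := rfl
      rw [hmi]
      omega
  · rw [hwabs]
    have ht := lam.type_le
    rcases Nat.eq_zero_or_pos lam.type with h0 | h0
    · have : μ 0 < k := lt_of_le_of_ne (hμk 0) (fun h => by have := htype.2 h; omega)
      rw [hu1 0 hk, hg5 hk this, hx0, if_pos (by norm_num), h0]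
    · have hm := htype.1 h0
      have h1 : 0 < g 0 := by
        have := hg1 0 0 hk (by omega)
        omega
      have h2 : 1 < u 0 := by
        rw [hu1 0 hk, ← hx0]; exact hxm h1
      rw [if_neg (by push_cast; omega)]
      split_ifs with h3
      · have : ¬ (0 ∈ S) := fun h => by have := (hwneg 0).2 h; omega
        rw [hS0 0 hk] at this
        have h4 : ¬ c0 := fun h => this ⟨rfl, h⟩
        have : lam.type ≠ 2 := fun h => h4 (Or.inl h)
        omega
      · have h5 : 0 ∈ S := by
          by_contra hcon
          have := hwnS 0 hcon
          have := hupos 0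
          omega
        rw [hS0 0 hk] at h5
        rcases h5.2 with h | h <;> omega

/-- The `k`-Grassmannian element `w_λ` corresponding to `lam` (it exists by `exists_corresponds`
when `k` is positive). -/
noncomputable def grassmannianElement {k : ℕ} (lam : TypedPartition k) : ℕ → ℤ :=
  Classical.epsilon fun w => Corresponds k w lam

theorem grassmannianElement_corresponds {k : ℕ} (hk : 0 < k) (lam : TypedPartition k) :
    Corresponds k (grassmannianElement lam) lam :=
  Classical.epsilon_spec (exists_corresponds hk lam)

/-- The pairs `(i, j)` with `i < j` and `w_{k+i} + w_{k+j} < 0` (positions from `0`). -/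
def pairSet {k : ℕ} (lam : TypedPartition k) : Set (ℕ × ℕ) :=
  {p | p.1 < p.2 ∧ grassmannianElement lam (k + p.1) + grassmannianElement lam (k + p.2) < 0}

/-- The sequence `β(λ)` (positions from `0`). -/
noncomputable def beta {k : ℕ} (lam : TypedPartition k) (j : ℕ) : ℤ :=
  if grassmannianElement lam (k + j) < 0 then grassmannianElement lam (k + j) + 1
  else grassmannianElement lam (k + j)

/-! ### The polynomial rings and the ring of double eta polynomials -/

/-- Names of the variables: `tilde` for `b̃_k`, and `b i` for `b_{i+1}`. -/
inductive BVar : Type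
  | tilde : BVar
  | b : ℕ → BVar

/-- `b_p` for an integer `p`, with `b_0 = 1` and `b_p = 0` for `p < 0`. -/
noncomputable def bPoly (A : Type) [CommRing A] : ℤ → MvPolynomial BVar A
  | Int.ofNat 0 => 1
  | Int.ofNat (i + 1) => X (BVar.b i)
  | Int.negSucc _ => 0

/-- `b̃_k`. -/
noncomputable def bTilde (A : Type) [CommRing A] : MvPolynomial BVar A := X BVar.tilde

/-- `c_p` for an integer `p`. -/
noncomputable def cPoly (A : Type) [CommRing A] (k : ℕ) (p : ℤ) : MvPolynomial BVar A :=
  if p < k then bPoly A p else if p = k then bPoly A k + bTilde A else 2 * bPoly A p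

/-- The left-hand side of the relation
`b_p b_p + ∑_{i=1}^p (-1)^i b_{p+i} c_{p-i} = 0`. -/
noncomputable def relationSquare (k p : ℕ) : MvPolynomial BVar ℤ :=
  bPoly ℤ p * bPoly ℤ p +
    ∑ i ∈ Finset.Icc 1 p, (-1) ^ i * bPoly ℤ ((p : ℤ) + i) * cPoly ℤ k ((p : ℤ) - i)

/-- The left-hand side of the relation
`b_k b̃_k + ∑_{i=1}^k (-1)^i b_{k+i} b_{k-i} = 0`. -/
noncomputable def relationTilde (k : ℕ) : MvPolynomial BVar ℤ :=
  bPoly ℤ k * bTilde ℤ +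
    ∑ i ∈ Finset.Icc 1 k, (-1) ^ i * bPoly ℤ ((k : ℤ) + i) * bPoly ℤ ((k : ℤ) - i)

/-- The ideal `J^{(k)}` of `ℤ[b]`. -/
noncomputable def idealJ (k : ℕ) : Ideal (MvPolynomial BVar ℤ) :=
  Ideal.span ({f | ∃ p, k < p ∧ f = relationSquare k p} ∪ {relationTilde k})

/-- `B^{(k)} = ℤ[b] / J^{(k)}`. -/
abbrev BRing (k : ℕ) : Type := MvPolynomial BVar ℤ ⧸ idealJ k

/-- `ℤ[t]`; the variable `X i` stands for `t_{i+1}`. -/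
abbrev ZT : Type := MvPolynomial ℕ ℤ

/-- `B^{(k)}[t]`, the ring of double eta polynomials. -/
abbrev BRingT (k : ℕ) : Type := MvPolynomial ℕ (BRing k)

/- The `ℤ[t]`-algebra structure on `B^{(k)}[t]`, extending the coefficients. -/
attribute [local instance] MvPolynomial.algebraMvPolynomial

/-- The class in `B^{(k)}[t]` of an element of `ℤ[b, t] = ℤ[b][t]`. -/
noncomputable def toBRingT (k : ℕ) : MvPolynomial ℕ (MvPolynomial BVar ℤ) →+* BRingT k :=
  MvPolynomial.map (Ideal.Quotient.mk (idealJ k))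

/-! ### Double eta polynomials

Because of the denominators `2`, they are formed in `ℚ[b, t] = ℚ[b][t]`. -/

/-- `ℚ[b, t]`. -/
abbrev QBT : Type := MvPolynomial ℕ (MvPolynomial BVar ℚ)

/-- `h^r_j(-t)`: the complete symmetric polynomial in `-t_1, ..., -t_r` if `0 ≤ r`, and the
elementary symmetric polynomial in `-t_1, ..., -t_{-r}` if `r < 0`. -/
noncomputable def hNeg : ℤ → ℕ → QBT
  | Int.ofNat r, j => aeval (fun i : Fin r => -(X (i : ℕ) : QBT)) (hsymm (Fin r) ℤ j)
  | Int.negSucc r, j =>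
      aeval (fun i : Fin (r + 1) => -(X (i : ℕ) : QBT)) (esymm (Fin (r + 1)) ℤ j)

/-- `e^r_j(-t)`, the elementary symmetric polynomial in `-t_1, ..., -t_r`. -/
noncomputable def eNeg (r j : ℕ) : QBT :=
  aeval (fun i : Fin r => -(X (i : ℕ) : QBT)) (esymm (Fin r) ℤ j)

section Factors

variable (k : ℕ)

/-- `∑_{j=1}^p c_{p-j} h^r_j(-t)`. -/
noncomputable def tailSum (r p : ℤ) : QBT :=
  ∑ j ∈ Finset.Icc 1 p.toNat, C (cPoly ℚ k (p - j)) * hNeg r j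

/-- `c^r_p = ∑_{j=0}^p c_{p-j} h^r_j(-t)`, an empty sum if `p < 0`. -/
noncomputable def cDouble (r p : ℤ) : QBT :=
  ∑ j ∈ Finset.range (p + 1).toNat, C (cPoly ℚ k (p - j)) * hNeg r j

/-- `a^s_p`. -/
noncomputable def aDouble (s p : ℤ) : QBT :=
  C ((1 / 2 : ℚ) • cPoly ℚ k p) + tailSum k s p

/-- `b^s_k`. -/
noncomputable def bDouble (s : ℤ) : QBT := C (bPoly ℚ k) + tailSum k s k

/-- `b̃^s_k`. -/
noncomputable def bTildeDouble (s : ℤ) : QBT := C (bTilde ℚ) + tailSum k s k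

/-- The factor `ĉ^r_p` at position `i`.  Positions are counted from `0` here, so that an odd
index is an even position. -/
noncomputable def cHat (i : ℕ) (r p : ℤ) : QBT :=
  cDouble k r p +
    if r = k - p ∧ r < 0 then
      C (2 * (if Even i then bTilde ℚ else bPoly ℚ k) - cPoly ℚ k k) *
        eNeg (p - k).toNat (p - k).toNat
    else 0

end Factors

/-- The index pairs `i < j` of the basic operators `R_{ij}` that act on the first `ℓ` entries. -/
abbrev RaisingPair (l : ℕ) : Type := {p : Fin l × Fin l // p.1 < p.2}

/-- The raising operators `∏ R_{ij}^{n_{ij}}` with `i < j ≤ ℓ`, given by their exponents.  (The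
operators that involve an index beyond the length `ℓ` of the partition make some entry beyond
position `ℓ` negative and contribute nothing.) -/
abbrev RaisingOp (l : ℕ) : Type := RaisingPair l → ℕ

section Eta

variable {k : ℕ} (lam : TypedPartition k)

/-- The coefficient of a raising operator in the expansion of
`R^λ = ∏_{i<j} (1 - R_{ij}) ∏_{(i,j) ∈ C(λ)} (1 + R_{ij})⁻¹`.
Note that `(1 - x) / (1 + x) = 1 + ∑_{n ≥ 1} 2 (-1)^n x^n`. -/
noncomputable def raisingCoeff (R : RaisingOp lam.length) : ℚ :=
  open Classical in
  ∏ p : RaisingPair lam.length,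
    if R p = 0 then 1
    else if ((p.1.1 : ℕ), (p.1.2 : ℕ)) ∈ pairSet lam then 2 * (-1) ^ R p
    else if R p = 1 then -1 else 0

/-- The entries of `ν = R λ`. -/
def raised (R : RaisingOp lam.length) (i : Fin lam.length) : ℤ :=
  (lam.part i : ℤ) + (∑ p : RaisingPair lam.length, if p.1.1 = i then (R p : ℤ) else 0)
    - ∑ p : RaisingPair lam.length, if p.1.2 = i then (R p : ℤ) else 0

/-- `i ∈ supp_m(R)` for `m = ℓ_k(λ) + 1`. -/
def inSupp (R : RaisingOp lam.length) (i : Fin lam.length) : Prop :=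
  ∃ p : RaisingPair lam.length, 0 < R p ∧ (p.1.2 : ℕ) < lam.numLarge ∧ (i = p.1.1 ∨ i = p.1.2)

/-- `R` involves a factor `R_{ij}` with `i = m` or `j = m`, for `m = ℓ_k(λ) + 1`. -/
def involvesM (R : RaisingOp lam.length) : Prop :=
  ∃ p : RaisingPair lam.length,
    0 < R p ∧ ((p.1.1 : ℕ) = lam.numLarge ∨ (p.1.2 : ℕ) = lam.numLarge)

/-- The factor `c̄` at position `i`. -/
noncomputable def cBar (R : RaisingOp lam.length) (i : Fin lam.length) : QBT :=
  open Classical in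
  if inSupp lam R i then cDouble k (beta lam i) (raised lam R i)
  else cHat k i (beta lam i) (raised lam R i)

/-- The factor at position `i` of the product `R ⋆ ĉ^β_λ`. -/
noncomputable def starFactor (R : RaisingOp lam.length) (i : Fin lam.length) : QBT :=
  open Classical in
  if lam.type = 0 ∨ (i : ℕ) < lam.numLarge then cBar lam R i
  else if (i : ℕ) = lam.numLarge then
    if involvesM lam R then aDouble k (beta lam i) (raised lam R i)
    else if lam.type = 1 then bDouble k (beta lam i)
    else bTildeDouble k (beta lam i)
  else cDouble k (beta lam i) (raised lam R i)

/-- `R ⋆ ĉ^β_λ`. -/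
noncomputable def starProduct (R : RaisingOp lam.length) : QBT := ∏ i, starFactor lam R i

/-- The double eta polynomial `H_λ(c | t) = 2^{-ℓ_k(λ)} R^λ ⋆ ĉ^{β(λ)}_λ`.  The sum over all
raising operators has finitely many nonzero terms, see `finite_support_starProduct`. -/
noncomputable def doubleEta : QBT :=
  ((1 / 2 : ℚ) ^ lam.numLarge) •
    ∑ᶠ R : RaisingOp lam.length, raisingCoeff lam R • starProduct lam R

/-- The single eta polynomial `H_λ(c) = H_λ(c | 0)`. -/
noncomputable def singleEta : MvPolynomial BVar ℚ :=
  MvPolynomial.eval (fun _ => 0) (doubleEta lam)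

/-- The monomial `b_λ = 2^{-ℓ_k(λ)} c_λ`. -/
noncomputable def bMonomial : MvPolynomial BVar ℚ :=
  ((1 / 2 : ℚ) ^ lam.numLarge) •
    ∏ i : Fin lam.length,
      if 0 < lam.type ∧ (i : ℕ) = lam.numLarge then
        if lam.type = 1 then bPoly ℚ k else bTilde ℚ
      else cPoly ℚ k (lam.part i)

theorem cDouble_neg (r p : ℤ) (hp : p < 0) : cDouble k r p = 0 := by
  unfold cDouble
  rw [show (p + 1).toNat = 0 by omega]
  simp

theorem cPoly_neg (A : Type) [CommRing A] (p : ℤ) (hp : p < 0) : cPoly A k p = 0 := by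
  obtain ⟨n, rfl⟩ := Int.eq_negSucc_of_lt_zero hp
  rw [cPoly, if_pos (by omega)]
  rfl

theorem cHat_neg (i : ℕ) (r p : ℤ) (hp : p < 0) : cHat k i r p = 0 := by
  rw [cHat, cDouble_neg r p hp, if_neg (by omega), zero_add]

theorem aDouble_neg (s p : ℤ) (hp : p < 0) : aDouble k s p = 0 := by
  rw [aDouble, tailSum, cPoly_neg ℚ p hp, show p.toNat = 0 by omega]
  simp

theorem starFactor_eq_zero (R : RaisingOp lam.length) (i : Fin lam.length)
    (h : raised lam R i < 0) : starFactor lam R i = 0 := by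
  unfold starFactor cBar
  split_ifs with h1 h2 h3 h4 h5
  · exact cDouble_neg _ _ h
  · exact cHat_neg _ _ _ h
  · exact aDouble_neg _ _ h
  all_goals try exact cDouble_neg _ _ h
  all_goals
    exfalso
    unfold raised at h
    have h0 : ∀ p : RaisingPair lam.length, (if p.1.2 = i then (R p : ℤ) else 0) = 0 := by
      intro p
      split_ifs with hp
      · by_contra hR
        exact h4 ⟨p, by omega, Or.inr (by rw [hp]; exact h3)⟩
      · rfl
    rw [Finset.sum_congr rfl (fun p _ => h0 p), Finset.sum_const_zero] at h
    have h6 : 0 ≤ ∑ p : RaisingPair lam.length, if p.1.1 = i then (R p : ℤ) else 0 :=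
      Finset.sum_nonneg fun p _ => by split_ifs <;> positivity
    omega

/-- Only finitely many raising operators contribute to a double eta polynomial. -/
theorem finite_support_starProduct :
    (Function.support fun R : RaisingOp lam.length => raisingCoeff lam R • starProduct lam R).Finite := by
  classical
  set M : ℕ := ∑ i : Fin lam.length, lam.part i * lam.length with hM
  refine Set.Finite.subset (Set.Finite.pi' fun _ : RaisingPair lam.length =>
    Set.finite_Iic M) fun R hR => ?_
  have hnn : ∀ i, 0 ≤ raised lam R i := by
    intro i
    by_contra hcon
    push Not at hcon
    apply hR
    show raisingCoeff lam R • starProduct lam R = 0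
    rw [starProduct, Finset.prod_eq_zero (Finset.mem_univ i) (starFactor_eq_zero lam R i hcon), smul_zero]
  -- the moment `∑ i * ν_i` drops by at least the total number of basic operators
  have hsum : ∑ i : Fin lam.length, (i : ℤ) * raised lam R i =
      (∑ i : Fin lam.length, (i : ℤ) * lam.part i) +
        ∑ p : RaisingPair lam.length, ((p.1.1 : ℕ) - (p.1.2 : ℕ) : ℤ) * R p := by
    have e1 : ∀ g : RaisingPair lam.length → Fin lam.length,
        ∑ i : Fin lam.length, (i : ℤ) *
          ∑ p : RaisingPair lam.length, (if g p = i then (R p : ℤ) else 0) =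
        ∑ p : RaisingPair lam.length, ((g p : ℕ) : ℤ) * R p := by
      intro g
      simp_rw [Finset.mul_sum]
      rw [Finset.sum_comm]
      refine Finset.sum_congr rfl fun p _ => ?_
      simp
    simp only [raised, mul_sub, mul_add, Finset.sum_sub_distrib, Finset.sum_add_distrib, sub_mul]
    rw [e1 fun p => p.1.1, e1 fun p => p.1.2]
    ring
  have h0 : 0 ≤ ∑ i : Fin lam.length, (i : ℤ) * raised lam R i :=
    Finset.sum_nonneg fun i _ => mul_nonneg (by positivity) (hnn i)
  have h1 : ∑ p : RaisingPair lam.length, ((p.1.1 : ℕ) - (p.1.2 : ℕ) : ℤ) * R p ≤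
      - ∑ p : RaisingPair lam.length, (R p : ℤ) := by
    rw [← Finset.sum_neg_distrib]
    refine Finset.sum_le_sum fun p _ => ?_
    have hp : (p.1.1 : ℕ) < (p.1.2 : ℕ) := p.2
    have hR0 : (0 : ℤ) ≤ R p := by positivity
    nlinarith
  have h2 : ∑ i : Fin lam.length, (i : ℤ) * lam.part i ≤ M := by
    rw [hM]
    push_cast
    refine Finset.sum_le_sum fun i _ => ?_
    have := i.2
    rw [mul_comm]
    gcongr
  intro p
  have h3 : (R p : ℤ) ≤ ∑ p : RaisingPair lam.length, (R p : ℤ) :=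
    Finset.single_le_sum (f := fun p => (R p : ℤ)) (fun q _ => by positivity) (Finset.mem_univ p)
  show R p ≤ M
  omega

end Eta

/-! ### Integral forms -/

/-- `f ∈ ℤ[b]` is the given element of `ℚ[b]`. -/
def IsIntegralForm (f : MvPolynomial BVar ℤ) (g : MvPolynomial BVar ℚ) : Prop :=
  MvPolynomial.map (Int.castRingHom ℚ) f = g

/-- `f ∈ ℤ[b, t]` is the given element of `ℚ[b, t]`. -/
def IsIntegralFormT (f : MvPolynomial ℕ (MvPolynomial BVar ℤ)) (g : QBT) : Prop :=
  MvPolynomial.map (MvPolynomial.map (Int.castRingHom ℚ)) f = g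

/-!
The proof compares all three families with the monomials `b_λ` by triangularity, and reduces the
linear independence of the `b_λ` to the fact that the leading terms of the relations are coprime.

*Statistics.*  To a multiset of parts `p` attach the sums of the truncated differences `p - c`,
for all `c`, and the sum of the squares `p ^ 2` (`partStat`, `monStat`).  These are additive over
products of monomials.  For two partitions of the same number, larger truncated differences mean
larger partial sums, that is, dominance, and a larger sum of squares makes the dominance strict
(`TypedPartition.strictlyDominates_or_size_lt`).  `statSpan σ` is the span of the monomials of
smaller degree, or of the same degree with statistics at least `σ`; it is a multiplicative
filtration, and `HasLead` expresses that two elements agree modulo the next step `σ + statBump`.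

*The basis `b_λ`.*  By convexity, `b_p ^ 2` for `p > k` and `b_k b̃_k` are the leading terms of
the relations.  These monomials are pairwise coprime, so every monomial factors uniquely as a
standard monomial times a product of leading monomials.  Replacing the leading monomials by the
relations gives a family that is unitriangular with respect to the monomials, hence a basis of
`ℤ[b]` (`exists_adaptedBasis`), and the ideal of relations is spanned by its members with
nonstandard index (`idealJ_eq_span`).  So the standard monomials form a basis of the quotient.
They are indexed by typed `k`-strict partitions, and `b_λ` has the standard monomial of `λ` as its
leading term, because `c_k = b_k + b̃_k` may be replaced by `b_k` next to `b_k`, and by `b̃_k`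
next to `b̃_k` (`mk_bMonomialInt_sub_mem`).

*Eta polynomials.*  Every raising operator `R` contributes a product over the positions `i` of
`λ`. The coefficient of `R` is regrouped as a product over the positions that are lowered.  The
denominator `2` at a position `i ≤ ℓ_k(λ)` cancels: if the entry is lowered, then the pairs
involved belong to `C(λ)` and the coefficient is even; if it is raised, then all `c_q` that occur
have `q > k`; and if it is fixed, then the correction term in `ĉ` removes the only odd
contribution (`factorIntegral`).  The same argument treats the factor `a` at the first part `k`.
If `R` is nontrivial then `R λ` has strictly larger statistics than `λ` (`statLE_raised`), while
the trivial `R` gives `b_λ` modulo lower degree.  So `H_λ(c | t)` is led by `b_λ`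
(`exists_integral_doubleEta`), which yields both the expansion and, by triangularity, the
remaining bases.
-/

/-! ### Triangular families of vectors -/

section Triangular

variable {ι R M α : Type*} [CommRing R] [AddCommGroup M] [Module R M] [LinearOrder α]

/-- If `v` is unitriangular with respect to `e`, along relations that refine a transitive relation
`r`, then each `e i` is a combination of the `v j` with `r i j`. -/
theorem mem_span_of_triangular [WellFoundedLT α] {e v : ι → M} (f : ι → α) (r : ι → ι → Prop)
    (hrefl : ∀ i, r i i) (htrans : ∀ i j l, r i j → r j l → r i l)
    (h : ∀ i, v i - e i ∈ Submodule.span R (e '' {j | r i j ∧ f j < f i})) (i : ι) :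
    e i ∈ Submodule.span R (v '' {j | r i j}) := by
  induction hi : f i using WellFoundedLT.induction generalizing i with
  | ind a ih =>
    have h1 : v i - e i ∈ Submodule.span R (v '' {j | r i j}) := by
      refine Submodule.span_le.2 ?_ (h i)
      rintro _ ⟨j, ⟨hij, hj⟩, rfl⟩
      refine Submodule.span_mono (Set.image_mono ?_) (ih (f j) (hi ▸ hj) j rfl)
      exact fun l hl => htrans _ _ _ hij hl
    have h2 : v i ∈ Submodule.span R (v '' {j | r i j}) :=
      Submodule.subset_span ⟨i, hrefl i, rfl⟩
    simpa using Submodule.sub_mem _ h2 h1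

/-- A family that is unitriangular with respect to a basis is a basis. -/
theorem exists_basis_of_triangular [WellFoundedLT α] (e : Module.Basis ι R M) (v : ι → M)
    (f : ι → α) (h : ∀ i, v i - e i ∈ Submodule.span R (e '' {j | f j < f i})) :
    ∃ e' : Module.Basis ι R M, ∀ i, e' i = v i := by
  classical
  have hcoord : ∀ i j, f i ≤ f j → e.coord j (v i) = if i = j then 1 else 0 := by
    intro i j hij
    have h0 : e.coord j (v i - e i) = 0 := by
      have hle : Submodule.span R (e '' {l | f l < f i}) ≤ LinearMap.ker (e.coord j) := by
        rw [Submodule.span_le]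
        rintro _ ⟨l, hl, rfl⟩
        have hne : l ≠ j := fun hlj => by
          subst hlj
          exact absurd hl (not_lt.2 hij)
        simp [hne]
      exact hle (h i)
    rw [map_sub, sub_eq_zero] at h0
    rw [h0]
    simp [Finsupp.single_apply]
  have hli : LinearIndependent R v := by
    rw [linearIndependent_iff]
    intro x hx
    by_contra hne
    -- a coordinate of maximal rank in the support receives no contribution from the other terms
    obtain ⟨j, hj, hmax⟩ := Finset.exists_max_image x.support f
      (Finsupp.support_nonempty_iff.2 hne)
    have h1 := congrArg (e.coord j) hx
    rw [Finsupp.linearCombination_apply, Finsupp.sum, map_sum, map_zero] at h1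
    have h2 : ∀ i ∈ x.support, e.coord j (x i • v i) = if i = j then x j else 0 := by
      intro i hi
      rw [map_smul, hcoord i j (hmax i hi)]
      split_ifs with hij
      · simp [hij]
      · simp
    rw [Finset.sum_congr rfl h2, Finset.sum_ite_eq' x.support j, if_pos hj] at h1
    exact Finsupp.mem_support_iff.1 hj h1
  have hsp : ⊤ ≤ Submodule.span R (Set.range v) := by
    rw [← e.span_eq, Submodule.span_le]
    rintro _ ⟨i, rfl⟩
    refine Submodule.span_mono (Set.image_subset_range v {j | True})
      (mem_span_of_triangular f (fun _ _ => True) (fun _ => trivial) (fun _ _ _ _ _ => trivial)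
        (fun i => ?_) i)
    simpa using h i
  exact ⟨Module.Basis.mk hli hsp, fun i => Module.Basis.mk_apply hli hsp i⟩

end Triangular

/-! ### Dominance statistics and the filtration by them -/

/-- The statistics of a part `p`: its square, and its truncated differences `p - c`.  Summed over
the parts of two partitions of the same number, the truncated differences compare them in the
dominance order, and the squares detect strict dominance.  The entry at `some 0` sums to the
size. -/
def partStat (p : ℕ) : Option ℕ → ℕ
  | none => p ^ 2
  | some c => p - c

@[simp] theorem partStat_none (p : ℕ) : partStat p none = p ^ 2 := rfl

@[simp] theorem partStat_some (p c : ℕ) : partStat p (some c) = p - c := rfl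

theorem partStat_zero : partStat 0 = 0 := by
  funext o
  cases o <;> simp

/-- The degree of a variable. -/
def BVar.degree (k : ℕ) : BVar → ℕ
  | BVar.tilde => k
  | BVar.b i => i + 1

/-- The sum of the statistics of the degrees of the variables of a monomial. -/
noncomputable def monStat (k : ℕ) : (BVar →₀ ℕ) →+ (Option ℕ → ℕ) :=
  Finsupp.weight fun v => partStat (v.degree k)

theorem monStat_single (k : ℕ) (v : BVar) (n : ℕ) :
    monStat k (Finsupp.single v n) = n • partStat (v.degree k) := by
  simp [monStat, Finsupp.weight_single]

/-- `τ` has smaller size than `σ`, or has the same size and dominates `σ`. -/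
def StatLE (σ τ : Option ℕ → ℕ) : Prop :=
  τ (some 0) < σ (some 0) ∨ (τ (some 0) = σ (some 0) ∧ σ ≤ τ)

/-- Adding this makes a comparison of statistics strict in the sum of squares. -/
def statBump : Option ℕ → ℕ := Pi.single none 1

@[simp] theorem statBump_none : statBump none = 1 := by simp [statBump]

@[simp] theorem statBump_some (c : ℕ) : statBump (some c) = 0 := by simp [statBump]

theorem StatLE.refl (σ : Option ℕ → ℕ) : StatLE σ σ := Or.inr ⟨rfl, le_rfl⟩

theorem StatLE.trans {σ τ υ : Option ℕ → ℕ} (h : StatLE σ τ) (h' : StatLE τ υ) : StatLE σ υ := by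
  rcases h with h | ⟨h1, h2⟩ <;> rcases h' with h' | ⟨h3, h4⟩
  · exact Or.inl (h'.trans h)
  · exact Or.inl (by omega)
  · exact Or.inl (by omega)
  · exact Or.inr ⟨h3.trans h1, h2.trans h4⟩

theorem StatLE.add {σ τ σ' τ' : Option ℕ → ℕ} (h : StatLE σ τ) (h' : StatLE σ' τ') :
    StatLE (σ + σ') (τ + τ') := by
  unfold StatLE at *
  simp only [Pi.add_apply]
  rcases h with h | ⟨h1, h2⟩ <;> rcases h' with h' | ⟨h3, h4⟩
  · exact Or.inl (by omega)
  · exact Or.inl (by omega)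
  · exact Or.inl (by omega)
  · exact Or.inr ⟨by omega, add_le_add h2 h4⟩

theorem statLE_bump (σ : Option ℕ → ℕ) : StatLE σ (σ + statBump) :=
  Or.inr ⟨by simp, fun o => by simp⟩

/-- Moving two equal parts `p` apart makes the statistics strictly larger, by convexity. -/
theorem statLE_split {p i : ℕ} (hi : 0 < i) (hip : i ≤ p) :
    StatLE (partStat p + partStat p + statBump) (partStat (p + i) + partStat (p - i)) := by
  refine Or.inr ⟨by simp; omega, fun o => ?_⟩
  cases o with
  | none =>
    obtain ⟨q, rfl⟩ := Nat.exists_eq_add_of_le hip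
    simp
    nlinarith
  | some c => simp; omega

section Filtration

variable (R : Type*) {S : Type*} [CommRing R] [CommRing S] [Algebra R S] (k : ℕ)
  (φ : MvPolynomial BVar ℤ →+* S)

/-- The span of the images of the monomials whose statistics are bounded by `σ` in the sense of
`StatLE`. -/
noncomputable def statSpan (σ : Option ℕ → ℕ) : Submodule R S :=
  Submodule.span R ((fun m => φ (monomial m 1)) '' {m | StatLE σ (monStat k m)})

variable {R k φ}

theorem statSpan_anti {σ τ : Option ℕ → ℕ} (h : StatLE σ τ) :
    statSpan R k φ τ ≤ statSpan R k φ σ :=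
  Submodule.span_mono (Set.image_mono fun _ hm => h.trans hm)

theorem mul_mem_statSpan {σ τ : Option ℕ → ℕ} {x y : S} (hx : x ∈ statSpan R k φ σ)
    (hy : y ∈ statSpan R k φ τ) : x * y ∈ statSpan R k φ (σ + τ) := by
  have h := Submodule.mul_mem_mul hx hy
  rw [statSpan, statSpan, Submodule.span_mul_span] at h
  refine Submodule.span_mono ?_ h
  rintro _ ⟨_, ⟨m, hm, rfl⟩, _, ⟨n, hn, rfl⟩, rfl⟩
  refine ⟨m + n, ?_, ?_⟩
  · show StatLE _ _
    rw [map_add]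
    exact StatLE.add hm hn
  · simp [← map_mul, monomial_mul]

theorem monomial_mem_statSpan {σ : Option ℕ → ℕ} {m : BVar →₀ ℕ} (h : StatLE σ (monStat k m)) :
    φ (monomial m 1) ∈ statSpan R k φ σ :=
  Submodule.subset_span ⟨m, h, rfl⟩

theorem X_mem_statSpan (v : BVar) : φ (X v) ∈ statSpan R k φ (partStat (v.degree k)) := by
  apply monomial_mem_statSpan
  rw [monStat_single, one_smul]
  exact StatLE.refl _

theorem one_mem_statSpan : (1 : S) ∈ statSpan R k φ 0 := by
  have := monomial_mem_statSpan (R := R) (φ := φ) (k := k) (σ := 0) (m := 0)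
    (by rw [map_zero]; exact StatLE.refl _)
  simpa using this

theorem intCast_mul_mem_statSpan {σ : Option ℕ → ℕ} {x : S} (n : ℤ)
    (hx : x ∈ statSpan R k φ σ) : (n : S) * x ∈ statSpan R k φ σ := by
  rw [← zsmul_eq_mul]
  exact zsmul_mem hx n

/-- A ring homomorphism that is semilinear over the scalars preserves the filtration. -/
theorem map_mem_statSpan {R' S' : Type*} [CommRing R'] [CommRing S'] [Algebra R' S']
    (ρ : R →+* R') (ψ : S →+* S') (hψ : ∀ (a : R) (x : S), ψ (a • x) = ρ a • ψ x)
    {σ : Option ℕ → ℕ} {x : S} (hx : x ∈ statSpan R k φ σ) :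
    ψ x ∈ statSpan R' k (ψ.comp φ) σ := by
  induction hx using Submodule.span_induction with
  | mem x hx =>
    obtain ⟨m, hm, rfl⟩ := hx
    exact monomial_mem_statSpan (φ := ψ.comp φ) hm
  | zero => rw [map_zero]; exact zero_mem _
  | add x y _ _ hx hy => rw [map_add]; exact add_mem hx hy
  | smul a x _ hx => rw [hψ]; exact Submodule.smul_mem _ _ hx

variable (R k φ)

/-- `x₀` is a leading term of `x` at the statistics `σ`. -/
def HasLead (σ : Option ℕ → ℕ) (x₀ x : S) : Prop :=
  x₀ ∈ statSpan R k φ σ ∧ x - x₀ ∈ statSpan R k φ (σ + statBump)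

variable {R k φ}

theorem HasLead.refl {σ : Option ℕ → ℕ} {x : S} (h : x ∈ statSpan R k φ σ) :
    HasLead R k φ σ x x := ⟨h, by simp⟩

theorem HasLead.mem {σ : Option ℕ → ℕ} {x₀ x : S} (h : HasLead R k φ σ x₀ x) :
    x ∈ statSpan R k φ σ := by
  have := add_mem (statSpan_anti (statLE_bump σ) h.2) h.1
  simpa using this

theorem HasLead.mul {σ τ : Option ℕ → ℕ} {x₀ x y₀ y : S} (hx : HasLead R k φ σ x₀ x)
    (hy : HasLead R k φ τ y₀ y) : HasLead R k φ (σ + τ) (x₀ * y₀) (x * y) := by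
  refine ⟨mul_mem_statSpan hx.1 hy.1, ?_⟩
  have h1 := mul_mem_statSpan hx.2 hy.mem
  have h2 := mul_mem_statSpan hx.1 hy.2
  rw [show σ + statBump + τ = σ + τ + statBump by abel] at h1
  rw [← add_assoc] at h2
  convert add_mem h1 h2 using 1
  ring

theorem HasLead.one : HasLead R k φ 0 1 1 := HasLead.refl one_mem_statSpan

theorem HasLead.pow {σ : Option ℕ → ℕ} {x₀ x : S} (h : HasLead R k φ σ x₀ x) (n : ℕ) :
    HasLead R k φ (n • σ) (x₀ ^ n) (x ^ n) := by
  induction n with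
  | zero => simpa using HasLead.one
  | succ n ih => rw [pow_succ, pow_succ, succ_nsmul]; exact ih.mul h

theorem HasLead.prod {ι : Type*} (s : Finset ι) {σ : ι → Option ℕ → ℕ} {x₀ x : ι → S}
    (h : ∀ i ∈ s, HasLead R k φ (σ i) (x₀ i) (x i)) :
    HasLead R k φ (∑ i ∈ s, σ i) (∏ i ∈ s, x₀ i) (∏ i ∈ s, x i) := by
  classical
  induction s using Finset.induction_on with
  | empty => simpa using HasLead.one
  | insert a s ha ih =>
    rw [Finset.sum_insert ha, Finset.prod_insert ha, Finset.prod_insert ha]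
    exact (h a (Finset.mem_insert_self a s)).mul
      (ih fun i hi => h i (Finset.mem_insert_of_mem hi))

theorem prod_mem_statSpan {ι : Type*} (s : Finset ι) {σ : ι → Option ℕ → ℕ} {x : ι → S}
    (h : ∀ i ∈ s, x i ∈ statSpan R k φ (σ i)) :
    ∏ i ∈ s, x i ∈ statSpan R k φ (∑ i ∈ s, σ i) :=
  (HasLead.prod s fun i hi => HasLead.refl (h i hi)).1

end Filtration

/-! ### The generators and relations -/

theorem bPoly_mem_statSpan {R S : Type*} [CommRing R] [CommRing S] [Algebra R S] {k : ℕ}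
    {φ : MvPolynomial BVar ℤ →+* S} (p : ℤ) :
    φ (bPoly ℤ p) ∈ statSpan R k φ (partStat p.toNat) := by
  rcases p with (_ | i) | i
  · simpa [bPoly, partStat_zero] using one_mem_statSpan
  · exact X_mem_statSpan (BVar.b i)
  · simp [bPoly]

theorem bTilde_mem_statSpan {R S : Type*} [CommRing R] [CommRing S] [Algebra R S] {k : ℕ}
    {φ : MvPolynomial BVar ℤ →+* S} :
    φ (bTilde ℤ) ∈ statSpan R k φ (partStat k) :=
  X_mem_statSpan BVar.tilde

theorem cPoly_mem_statSpan {R S : Type*} [CommRing R] [CommRing S] [Algebra R S] {k : ℕ}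
    {φ : MvPolynomial BVar ℤ →+* S} (p : ℤ) :
    φ (cPoly ℤ k p) ∈ statSpan R k φ (partStat p.toNat) := by
  unfold cPoly
  split_ifs with h1 h2
  · exact bPoly_mem_statSpan p
  · subst h2
    rw [map_add]
    exact add_mem (bPoly_mem_statSpan _) bTilde_mem_statSpan
  · rw [two_mul, map_add]
    exact add_mem (bPoly_mem_statSpan p) (bPoly_mem_statSpan p)

theorem bPoly_natCast {A : Type} [CommRing A] (p : ℕ) (hp : 0 < p) :
    bPoly A (p : ℤ) = X (BVar.b (p - 1)) := by
  obtain ⟨i, rfl⟩ := Nat.exists_eq_succ_of_ne_zero hp.ne'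
  rfl

/-- The relation for `b_p ^ 2` has leading term `b_p ^ 2`. -/
theorem hasLead_relationSquare {k : ℕ} (p : ℕ) :
    HasLead ℤ k (RingHom.id _) (partStat p + partStat p) (bPoly ℤ p * bPoly ℤ p)
      (relationSquare k p) := by
  refine ⟨mul_mem_statSpan (bPoly_mem_statSpan (φ := RingHom.id _) p)
    (bPoly_mem_statSpan (φ := RingHom.id _) p), ?_⟩
  rw [relationSquare, add_sub_cancel_left]
  refine sum_mem fun i hi => ?_
  rw [Finset.mem_Icc] at hi
  have h := mul_mem_statSpan
    (bPoly_mem_statSpan (R := ℤ) (k := k) (φ := RingHom.id _) ((p : ℤ) + i))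
    (cPoly_mem_statSpan (R := ℤ) (k := k) (φ := RingHom.id _) ((p : ℤ) - i))
  rw [show ((p : ℤ) + i).toNat = p + i by omega, show ((p : ℤ) - i).toNat = p - i by omega] at h
  have h2 := intCast_mul_mem_statSpan ((-1) ^ i) (statSpan_anti (statLE_split hi.1 hi.2) h)
  simpa [mul_assoc] using h2

/-- The relation for `b_k b̃_k` has leading term `b_k b̃_k`. -/
theorem hasLead_relationTilde {k : ℕ} :
    HasLead ℤ k (RingHom.id _) (partStat k + partStat k) (bPoly ℤ k * bTilde ℤ)
      (relationTilde k) := by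
  refine ⟨mul_mem_statSpan (bPoly_mem_statSpan (φ := RingHom.id _) k)
    (bTilde_mem_statSpan (φ := RingHom.id _)), ?_⟩
  rw [relationTilde, add_sub_cancel_left]
  refine sum_mem fun i hi => ?_
  rw [Finset.mem_Icc] at hi
  have h := mul_mem_statSpan
    (bPoly_mem_statSpan (R := ℤ) (k := k) (φ := RingHom.id _) ((k : ℤ) + i))
    (bPoly_mem_statSpan (R := ℤ) (k := k) (φ := RingHom.id _) ((k : ℤ) - i))
  rw [show ((k : ℤ) + i).toNat = k + i by omega, show ((k : ℤ) - i).toNat = k - i by omega] at h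
  have h2 := intCast_mul_mem_statSpan ((-1) ^ i) (statSpan_anti (statLE_split hi.1 hi.2) h)
  simpa [mul_assoc] using h2

/-! ### A basis of the polynomial ring adapted to the relations -/

section AdaptedBasis

/-- The contribution of a variable other than `b_k` and `b̃_k`, with exponent `n`, to the adapted
basis: for `p > k` as many factors `b_p ^ 2` as possible are replaced by the relation which they
lead. -/
noncomputable def adaptedFactor (k : ℕ) : BVar → ℕ → MvPolynomial BVar ℤ
  | BVar.tilde, _ => 1
  | BVar.b i, n =>
    if k < i + 1 then X (BVar.b i) ^ (n % 2) * relationSquare k (i + 1) ^ (n / 2)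
    else if k = i + 1 then 1 else X (BVar.b i) ^ n

/-- The contribution of `b_k ^ x * b̃_k ^ y` to the adapted basis. -/
noncomputable def adaptedPair (k x y : ℕ) : MvPolynomial BVar ℤ :=
  X (BVar.b (k - 1)) ^ (x - min x y) * X BVar.tilde ^ (y - min x y) * relationTilde k ^ min x y

/-- The polynomial attached to a monomial: its divisors `b_p ^ 2`, with `p > k`, and `b_k b̃_k`,
which are pairwise coprime, are replaced by the relations which they lead. -/
noncomputable def adaptedVector (k : ℕ) (m : BVar →₀ ℕ) : MvPolynomial BVar ℤ :=
  m.prod (adaptedFactor k) * adaptedPair k (m (BVar.b (k - 1))) (m BVar.tilde)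

/-- The monomials that are not divisible by the leading monomial of a relation. -/
def standardMonomials (k : ℕ) : Set (BVar →₀ ℕ) :=
  {m | (∀ i, k < i + 1 → m (BVar.b i) < 2) ∧ (m (BVar.b (k - 1)) = 0 ∨ m BVar.tilde = 0)}

variable {k : ℕ}

theorem adaptedFactor_zero (v : BVar) : adaptedFactor k v 0 = 1 := by
  cases v with
  | tilde => rfl
  | b i => simp [adaptedFactor]

/-- The leading monomial of an adapted basis vector is the given monomial. -/
theorem hasLead_adaptedVector (hk : 0 < k) (m : BVar →₀ ℕ) :
    HasLead ℤ k (RingHom.id _) (monStat k m) (monomial m 1) (adaptedVector k m) := by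
  classical
  obtain ⟨k, rfl⟩ := Nat.exists_eq_succ_of_ne_zero hk.ne'
  simp only [Nat.succ_eq_add_one] at *
  -- the exponents of `b_k` and `b̃_k` are split off
  set m' : BVar →₀ ℕ := (m.erase (BVar.b k)).erase BVar.tilde with hm'
  have hm : m = m' + (Finsupp.single (BVar.b k) (m (BVar.b k)) +
      Finsupp.single BVar.tilde (m BVar.tilde)) := by
    ext v
    simp only [hm', Finsupp.add_apply, Finsupp.single_apply, Finsupp.erase_apply]
    by_cases h1 : v = BVar.tilde
    · subst h1; simp
    · by_cases h2 : v = BVar.b k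
      · subst h2; simp
      · simp [h1, h2, Ne.symm h1, Ne.symm h2]
  have hprod : m.prod (adaptedFactor (k + 1)) = m'.prod (adaptedFactor (k + 1)) := by
    have h1 := Finsupp.mul_prod_erase' m (BVar.b k) (adaptedFactor (k + 1))
      fun v => adaptedFactor_zero v
    have h2 := Finsupp.mul_prod_erase' (m.erase (BVar.b k)) BVar.tilde (adaptedFactor (k + 1))
      fun v => adaptedFactor_zero v
    have h3 : adaptedFactor (k + 1) (BVar.b k) (m (BVar.b k)) = 1 := by simp [adaptedFactor]
    rw [h3, one_mul] at h1
    rw [show ∀ n, adaptedFactor (k + 1) BVar.tilde n = 1 from fun _ => rfl, one_mul] at h2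
    rw [← h1, ← h2]
  have hpair : HasLead ℤ (k + 1) (RingHom.id _)
      (m (BVar.b k) • partStat (k + 1) + m BVar.tilde • partStat (k + 1))
      (X (BVar.b k) ^ m (BVar.b k) * X BVar.tilde ^ m BVar.tilde)
      (adaptedPair (k + 1) (m (BVar.b k)) (m BVar.tilde)) := by
    generalize m (BVar.b k) = x
    generalize m BVar.tilde = y
    set d := min x y
    obtain ⟨x', hx⟩ : ∃ x', x = x' + d := ⟨x - d, by omega⟩
    obtain ⟨y', hy⟩ : ∃ y', y = y' + d := ⟨y - d, by omega⟩
    have hb : HasLead ℤ (k + 1) (RingHom.id (MvPolynomial BVar ℤ)) (partStat (k + 1))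
        (X (BVar.b k)) (X (BVar.b k)) :=
      HasLead.refl (X_mem_statSpan (φ := RingHom.id _) (BVar.b k))
    have ht : HasLead ℤ (k + 1) (RingHom.id (MvPolynomial BVar ℤ)) (partStat (k + 1))
        (X BVar.tilde) (X BVar.tilde) :=
      HasLead.refl (X_mem_statSpan (φ := RingHom.id _) BVar.tilde)
    have h := ((hb.pow x').mul (ht.pow y')).mul ((hasLead_relationTilde (k := k + 1)).pow d)
    have e1 : adaptedPair (k + 1) x y =
        X (BVar.b k) ^ x' * X BVar.tilde ^ y' * relationTilde (k + 1) ^ d := by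
      rw [adaptedPair, show x - min x y = x' by omega, show y - min x y = y' by omega]
      rfl
    rw [e1, hx, hy]
    convert h using 1
    · simp only [add_smul, smul_add]; abel
    · rw [bPoly_natCast (k + 1) (by omega), bTilde, mul_pow]
      simp only [Nat.add_sub_cancel]
      ring
  have hfac : HasLead ℤ (k + 1) (RingHom.id _) (monStat (k + 1) m') (monomial m' 1)
      (m'.prod (adaptedFactor (k + 1))) := by
    have e1 : monStat (k + 1) m' =
        ∑ v ∈ m'.support, m' v • partStat (v.degree (k + 1)) := by
      simp [monStat, Finsupp.weight_apply, Finsupp.sum]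
    rw [e1, monomial_eq, C_1, one_mul]
    refine HasLead.prod m'.support fun v hv => ?_
    rcases v with _ | i
    · simp [hm'] at hv
    · have hik : i ≠ k := fun h => by simp [hm', h] at hv
      simp only [adaptedFactor]
      have hb : HasLead ℤ (k + 1) (RingHom.id (MvPolynomial BVar ℤ)) (partStat (i + 1))
          (X (BVar.b i)) (X (BVar.b i)) :=
        HasLead.refl (X_mem_statSpan (φ := RingHom.id _) (BVar.b i))
      split_ifs with h1 h2
      · have h := (hb.pow (m' (BVar.b i) % 2)).mul
          ((hasLead_relationSquare (k := k + 1) (i + 1)).pow (m' (BVar.b i) / 2))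
        have hdm := Nat.mod_add_div (m' (BVar.b i)) 2
        convert h using 1
        · rw [← two_nsmul, smul_smul, ← add_smul, show m' (BVar.b i) % 2 + m' (BVar.b i) / 2 * 2 =
            m' (BVar.b i) by omega]
          rfl
        · rw [bPoly_natCast (i + 1) (by omega), ← pow_two, ← pow_mul, Nat.add_sub_cancel, ← pow_add,
            hdm]
      · omega
      · exact hb.pow _
  rw [adaptedVector, hprod]
  have h := hfac.mul hpair
  simp only [Nat.add_sub_cancel]
  convert h using 1
  · conv_lhs => rw [hm]
    simp only [map_add, monStat_single]
    rfl
  · conv_lhs => rw [hm]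
    rw [X_pow_eq_monomial, X_pow_eq_monomial, monomial_mul, monomial_mul]
    simp

theorem adaptedVector_add_square (hk : 0 < k) {i : ℕ} (hi : k < i + 1) (m : BVar →₀ ℕ) :
    adaptedVector k (m + Finsupp.single (BVar.b i) 2) =
      adaptedVector k m * relationSquare k (i + 1) := by
  classical
  have h0 : ∀ v, adaptedFactor k v 0 = 1 := adaptedFactor_zero
  have e1 := Finsupp.mul_prod_erase' (m + Finsupp.single (BVar.b i) 2) (BVar.b i) (adaptedFactor k)
    fun v => h0 v
  have e2 := Finsupp.mul_prod_erase' m (BVar.b i) (adaptedFactor k) fun v => h0 v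
  have e3 : (m + Finsupp.single (BVar.b i) 2).erase (BVar.b i) = m.erase (BVar.b i) := by
    ext v
    simp only [Finsupp.erase_apply, Finsupp.add_apply, Finsupp.single_apply]
    split_ifs <;> simp_all
  have e4 : adaptedFactor k (BVar.b i) (m (BVar.b i) + 2) =
      adaptedFactor k (BVar.b i) (m (BVar.b i)) * relationSquare k (i + 1) := by
    simp only [adaptedFactor, if_pos hi]
    rw [Nat.add_mod_right, Nat.add_div_right _ (by norm_num), pow_succ, mul_assoc]
  rw [adaptedVector, adaptedVector, ← e1, ← e2, e3]
  have hne : BVar.b i ≠ BVar.b (k - 1) := fun h => by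
    have h5 : i = k - 1 := BVar.b.inj h
    omega
  simp only [Finsupp.add_apply, Finsupp.single_eq_same, e4]
  rw [Finsupp.single_eq_of_ne' hne, Finsupp.single_eq_of_ne' (by simp), add_zero, add_zero]
  ring

theorem adaptedVector_add_pair (hk : 0 < k) (m : BVar →₀ ℕ) :
    adaptedVector k (m + (Finsupp.single (BVar.b (k - 1)) 1 + Finsupp.single BVar.tilde 1)) =
      adaptedVector k m * relationTilde k := by
  classical
  have h0 : ∀ v, adaptedFactor k v 0 = 1 := adaptedFactor_zero
  have hb : ∀ n, adaptedFactor k (BVar.b (k - 1)) n = 1 := fun n => by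
    simp only [adaptedFactor]
    rw [if_neg (by omega), if_pos (by omega)]
  have ht : ∀ n, adaptedFactor k BVar.tilde n = 1 := fun n => rfl
  have hprod : ∀ m : BVar →₀ ℕ, m.prod (adaptedFactor k) =
      ((m.erase (BVar.b (k - 1))).erase BVar.tilde).prod (adaptedFactor k) := by
    intro m
    have h1 := Finsupp.mul_prod_erase' m (BVar.b (k - 1)) (adaptedFactor k) fun v => h0 v
    have h2 := Finsupp.mul_prod_erase' (m.erase (BVar.b (k - 1))) BVar.tilde (adaptedFactor k)
      fun v => h0 v
    rw [hb, one_mul] at h1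
    rw [ht, one_mul] at h2
    rw [← h1, ← h2]
  have e3 : ((m + (Finsupp.single (BVar.b (k - 1)) 1 + Finsupp.single BVar.tilde 1)).erase
      (BVar.b (k - 1))).erase BVar.tilde = (m.erase (BVar.b (k - 1))).erase BVar.tilde := by
    ext v
    simp only [Finsupp.erase_apply, Finsupp.add_apply, Finsupp.single_apply]
    split_ifs <;> simp_all
  rw [adaptedVector, adaptedVector, hprod, e3, ← hprod, mul_assoc]
  congr 1
  simp only [Finsupp.add_apply, Finsupp.single_eq_same]
  rw [Finsupp.single_eq_of_ne' (by simp), Finsupp.single_eq_of_ne' (by simp), add_zero, zero_add]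
  simp only [adaptedPair]
  generalize m (BVar.b (k - 1)) = x
  generalize m BVar.tilde = y
  rw [show min (x + 1) (y + 1) = min x y + 1 by omega, Nat.add_sub_add_right,
    Nat.add_sub_add_right, pow_succ, ← mul_assoc]

theorem adaptedVector_standard (hk : 0 < k) {m : BVar →₀ ℕ} (hm : m ∈ standardMonomials k) :
    adaptedVector k m = monomial m 1 := by
  classical
  obtain ⟨h1, h2⟩ := hm
  have hf : ∀ v ∈ m.support, adaptedFactor k v (m v) =
      (if v = BVar.b (k - 1) ∨ v = BVar.tilde then 1 else X v ^ m v) := by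
    intro v _
    rcases v with _ | i
    · simp [adaptedFactor]
    · simp only [adaptedFactor, BVar.b.injEq, reduceCtorEq, or_false]
      split_ifs with h3 h4 h5 h6
      · omega
      · have := h1 i h3
        rw [Nat.mod_eq_of_lt this, Nat.div_eq_of_lt this, pow_zero, mul_one]
      · rfl
      · omega
      · omega
      · rfl
  have hp : adaptedPair k (m (BVar.b (k - 1))) (m BVar.tilde) =
      X (BVar.b (k - 1)) ^ m (BVar.b (k - 1)) * X BVar.tilde ^ m BVar.tilde := by
    rw [adaptedPair, show min (m (BVar.b (k - 1))) (m BVar.tilde) = 0 by omega]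
    simp
  have hs : ∀ w, X w ^ m w =
      ∏ v ∈ m.support, (if v = w then (X v ^ m v : MvPolynomial BVar ℤ) else 1) := by
    intro w
    rw [Finset.prod_ite_eq']
    split_ifs with h
    · rfl
    · rw [Finsupp.notMem_support_iff.1 h, pow_zero]
  rw [adaptedVector, Finsupp.prod, Finset.prod_congr rfl hf, hp, monomial_eq, C_1, one_mul, hs, hs,
    ← Finset.prod_mul_distrib, ← Finset.prod_mul_distrib, Finsupp.prod]
  refine Finset.prod_congr rfl fun v _ => ?_
  by_cases h3 : v = BVar.b (k - 1)
  · simp [h3]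
  · by_cases h4 : v = BVar.tilde <;> simp [h3, h4]

/-- A number in which the size comes before the deficit of the sum of squares; it decreases along
strict comparisons of statistics.  The cube leaves room for the deficit, which is at most the square
of the size. -/
def statRank (σ : Option ℕ → ℕ) : ℕ := σ (some 0) ^ 3 + (σ (some 0) ^ 2 - σ none)

theorem statRank_lt {σ τ : Option ℕ → ℕ} (hτ : τ none ≤ τ (some 0) ^ 2)
    (h : StatLE (σ + statBump) τ) : statRank τ < statRank σ := by
  unfold statRank
  rcases h with h | ⟨h1, h2⟩
  · simp only [Pi.add_apply, statBump_some, add_zero] at h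
    have h3 : τ (some 0) ^ 3 + τ (some 0) ^ 2 < (τ (some 0) + 1) ^ 3 := by ring_nf; nlinarith
    have h4 : (τ (some 0) + 1) ^ 3 ≤ σ (some 0) ^ 3 := Nat.pow_le_pow_left h 3
    omega
  · simp only [Pi.add_apply, statBump_some, add_zero] at h1
    have := h2 none
    simp only [Pi.add_apply, statBump_none] at this
    rw [← h1]
    omega

/-- The sum of the squares of the parts is at most the square of their sum. -/
theorem sum_partStat_none_le {ι : Type*} (s : Finset ι) (p : ι → ℕ) :
    (∑ i ∈ s, partStat (p i)) none ≤ ((∑ i ∈ s, partStat (p i)) (some 0)) ^ 2 := by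
  simp only [Finset.sum_apply, partStat_none, partStat_some, Nat.sub_zero]
  exact Finset.sum_sq_le_sq_sum_of_nonneg fun _ _ => Nat.zero_le _

theorem monStat_none_le (m : BVar →₀ ℕ) : monStat k m none ≤ monStat k m (some 0) ^ 2 := by
  induction m using Finsupp.induction_linear with
  | zero => simp
  | add f g hf hg =>
    simp only [map_add, Pi.add_apply]
    rw [add_sq]
    have := Nat.zero_le (2 * monStat k f (some 0) * monStat k g (some 0))
    omega
  | single v n =>
    simp only [monStat_single, Pi.smul_apply, partStat_none, partStat_some, smul_eq_mul,
      Nat.sub_zero]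
    rw [mul_pow]
    exact Nat.mul_le_mul_right _ (Nat.le_self_pow (by norm_num) n)

theorem statSpan_bump_le (m : BVar →₀ ℕ) :
    statSpan ℤ k (RingHom.id (MvPolynomial BVar ℤ)) (monStat k m + statBump) ≤
      Submodule.span ℤ (basisMonomials BVar ℤ '' {n | StatLE (monStat k m) (monStat k n) ∧
        statRank (monStat k n) < statRank (monStat k m)}) := by
  refine Submodule.span_mono ?_
  rintro _ ⟨n, hn, rfl⟩
  exact ⟨n, ⟨(statLE_bump _).trans hn, statRank_lt (monStat_none_le n) hn⟩, by simp⟩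

theorem exists_adaptedBasis (hk : 0 < k) :
    ∃ V : Module.Basis (BVar →₀ ℕ) ℤ (MvPolynomial BVar ℤ), ∀ m, V m = adaptedVector k m := by
  refine exists_basis_of_triangular (basisMonomials BVar ℤ) _ (fun m => statRank (monStat k m))
    fun m => ?_
  rw [coe_basisMonomials]
  have h := statSpan_bump_le m (hasLead_adaptedVector hk m).2
  exact Submodule.span_mono (Set.image_mono fun n hn => hn.2) h

/-- A monomial is a combination of adapted basis vectors with larger statistics. -/
theorem monomial_mem_span_adaptedVector (hk : 0 < k) (m : BVar →₀ ℕ) :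
    monomial m (1 : ℤ) ∈ Submodule.span ℤ
      (adaptedVector k '' {n | StatLE (monStat k m) (monStat k n)}) := by
  have h := mem_span_of_triangular (R := ℤ) (e := basisMonomials BVar ℤ) (v := adaptedVector k)
    (fun m => statRank (monStat k m)) (fun m n => StatLE (monStat k m) (monStat k n))
    (fun _ => StatLE.refl _) (fun _ _ _ => StatLE.trans) (fun m => ?_) m
  · simpa using h
  · have h := statSpan_bump_le m (hasLead_adaptedVector hk m).2
    simpa using h

/-- The ideal of relations is spanned by the adapted basis vectors of the nonstandard monomials. -/
theorem idealJ_eq_span (hk : 0 < k) :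
    (idealJ k).restrictScalars ℤ =
      Submodule.span ℤ (adaptedVector k '' (standardMonomials k)ᶜ) := by
  obtain ⟨V, hV⟩ := exists_adaptedBasis hk
  have hV' : adaptedVector k = V := funext fun m => (hV m).symm
  apply le_antisymm
  · intro x hx
    rw [Submodule.restrictScalars_mem, idealJ] at hx
    have hmul : ∀ g, (∀ m, adaptedVector k m * g ∈
        Submodule.span ℤ (adaptedVector k '' (standardMonomials k)ᶜ)) →
        ∀ h, h * g ∈ Submodule.span ℤ (adaptedVector k '' (standardMonomials k)ᶜ) := by
      intro g hg h
      have hh : h ∈ Submodule.span ℤ (Set.range V) := by rw [V.span_eq]; trivial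
      induction hh using Submodule.span_induction with
      | mem x hx => obtain ⟨m, rfl⟩ := hx; rw [hV]; exact hg m
      | zero => simp
      | add x y _ _ hx hy => rw [add_mul]; exact add_mem hx hy
      | smul a x _ hx => rw [smul_mul_assoc]; exact Submodule.smul_mem _ _ hx
    suffices h : ∀ a, a * x ∈ Submodule.span ℤ (adaptedVector k '' (standardMonomials k)ᶜ) by
      simpa using h 1
    induction hx using Submodule.span_induction with
    | mem x hx =>
      refine hmul x fun m => ?_
      rcases hx with ⟨p, hp, rfl⟩ | rfl
      · obtain ⟨i, rfl⟩ := Nat.exists_eq_succ_of_ne_zero (by omega : p ≠ 0)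
        rw [Nat.succ_eq_add_one, ← adaptedVector_add_square hk hp]
        refine Submodule.subset_span ⟨_, fun h => ?_, rfl⟩
        have := h.1 i hp
        simp at this
      · rw [← adaptedVector_add_pair hk]
        refine Submodule.subset_span ⟨_, fun h => ?_, rfl⟩
        rcases h.2 with h | h <;> simp at h
    | zero => simp
    | add x y _ _ hx hy => intro a; rw [mul_add]; exact add_mem (hx a) (hy a)
    | smul b x _ hx => intro a; rw [smul_eq_mul, ← mul_assoc]; exact hx _
  · rw [Submodule.span_le]
    rintro _ ⟨m, hm, rfl⟩
    show adaptedVector k m ∈ idealJ k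
    have : (∃ i, k < i + 1 ∧ 2 ≤ m (BVar.b i)) ∨ (1 ≤ m (BVar.b (k - 1)) ∧ 1 ≤ m BVar.tilde) := by
      by_contra hcon
      push Not at hcon
      exact hm ⟨hcon.1, by omega⟩
    rcases this with ⟨i, hi, h2⟩ | ⟨h1, h2⟩
    · have hle : Finsupp.single (BVar.b i) 2 ≤ m := by
        rw [Finsupp.single_le_iff]; exact h2
      rw [← tsub_add_cancel_of_le hle, adaptedVector_add_square hk hi]
      exact Ideal.mul_mem_left _ _ (Ideal.subset_span (Or.inl ⟨i + 1, hi, rfl⟩))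
    · have hle : Finsupp.single (BVar.b (k - 1)) 1 + Finsupp.single BVar.tilde 1 ≤ m := by
        classical
        intro v
        simp only [Finsupp.add_apply, Finsupp.single_apply]
        rcases v with _ | i
        · simpa using h2
        · by_cases hi : k - 1 = i
          · subst hi; simpa using h1
          · simp [hi]
      rw [← tsub_add_cancel_of_le hle, adaptedVector_add_pair hk]
      exact Ideal.mul_mem_left _ _ (Ideal.subset_span (Or.inr rfl))

/-- The standard monomials form a basis of the quotient by the relations. -/
theorem exists_standardBasis (hk : 0 < k) :
    ∃ S : Module.Basis (standardMonomials k) ℤ (BRing k),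
      ∀ m, S m = Ideal.Quotient.mk (idealJ k) (monomial m.1 1) := by
  obtain ⟨V, hV⟩ := exists_adaptedBasis hk
  have hV' : adaptedVector k = V := funext fun m => (hV m).symm
  set π : MvPolynomial BVar ℤ →ₗ[ℤ] BRing k :=
    (Ideal.Quotient.mkₐ ℤ (idealJ k)).toLinearMap with hπ
  have hker : LinearMap.ker π = Submodule.span ℤ (V '' (standardMonomials k)ᶜ) := by
    rw [← hV', ← idealJ_eq_span hk]
    ext x
    simp [hπ, Ideal.Quotient.eq_zero_iff_mem]
  have hli : LinearIndependent ℤ (fun m : standardMonomials k => π (V m.1)) := by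
    refine LinearIndependent.map (V.linearIndependent.comp _ Subtype.val_injective) ?_
    rw [hker, Set.range_comp, Subtype.range_coe]
    exact V.linearIndependent.disjoint_span_image disjoint_compl_right
  have hsp : ⊤ ≤ Submodule.span ℤ (Set.range fun m : standardMonomials k => π (V m.1)) := by
    rintro y -
    obtain ⟨x, rfl⟩ : ∃ x, π x = y := Ideal.Quotient.mk_surjective y
    have hx : x ∈ Submodule.span ℤ (Set.range V) := by rw [V.span_eq]; trivial
    induction hx using Submodule.span_induction with
    | mem x hx =>
      obtain ⟨m, rfl⟩ := hx
      by_cases hm : m ∈ standardMonomials k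
      · exact Submodule.subset_span ⟨⟨m, hm⟩, rfl⟩
      · have : π (V m) = 0 := by
          rw [← LinearMap.mem_ker, hker]
          exact Submodule.subset_span ⟨m, hm, rfl⟩
        rw [this]
        exact zero_mem _
    | zero => simp
    | add x y _ _ hx hy => rw [map_add]; exact add_mem hx hy
    | smul a x _ hx => rw [map_smul]; exact Submodule.smul_mem _ _ hx
  refine ⟨Module.Basis.mk hli hsp, fun m => ?_⟩
  rw [Module.Basis.mk_apply, hV, adaptedVector_standard hk m.2]
  rfl

/-- The class of a monomial is a combination of classes of standard monomials with larger
statistics. -/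
theorem mk_monomial_mem_span_standard (hk : 0 < k) (m : BVar →₀ ℕ) :
    Ideal.Quotient.mk (idealJ k) (monomial m 1) ∈ Submodule.span ℤ
      ((fun n => Ideal.Quotient.mk (idealJ k) (monomial n 1)) ''
        {n | n ∈ standardMonomials k ∧ StatLE (monStat k m) (monStat k n)}) := by
  have h := Submodule.mem_map_of_mem (f := (Ideal.Quotient.mkₐ ℤ (idealJ k)).toLinearMap)
    (monomial_mem_span_adaptedVector hk m)
  rw [Submodule.map_span] at h
  refine Submodule.span_le.2 ?_ h
  rintro _ ⟨_, ⟨n, hn, rfl⟩, rfl⟩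
  by_cases hs : n ∈ standardMonomials k
  · refine Submodule.subset_span ⟨n, ⟨hs, hn⟩, ?_⟩
    rw [adaptedVector_standard hk hs]
    rfl
  · have : adaptedVector k n ∈ (idealJ k).restrictScalars ℤ := by
      rw [idealJ_eq_span hk]
      exact Submodule.subset_span ⟨n, hs, rfl⟩
    have h0 : Ideal.Quotient.mk (idealJ k) (adaptedVector k n) = 0 :=
      Ideal.Quotient.eq_zero_iff_mem.2 this
    show Ideal.Quotient.mk (idealJ k) (adaptedVector k n) ∈ _
    rw [h0]
    exact zero_mem _

end AdaptedBasis

/-! ### Standard monomials and typed partitions -/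

namespace TypedPartition

variable {k : ℕ}

/-- The variable that stands for a part `p` of a typed partition: `b_p`, except that a part `k` of a
partition of type `2` is represented by `b̃_k`. -/
def partVar (lam : TypedPartition k) (p : ℕ) : BVar :=
  if p = k ∧ lam.type = 2 then BVar.tilde else BVar.b (p - 1)

/-- The monomial whose variables stand for the parts. -/
noncomputable def monomial (lam : TypedPartition k) : BVar →₀ ℕ :=
  open Classical in
  Multiset.toFinsupp ((lam.parts : Multiset ℕ).map lam.partVar)

/-- The sum of the statistics of the parts. -/
def stat (lam : TypedPartition k) : Option ℕ → ℕ := (lam.parts.map partStat).sum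

theorem degree_partVar (lam : TypedPartition k) {p : ℕ} (hp : 0 < p) :
    (lam.partVar p).degree k = p := by
  unfold partVar
  split_ifs with h
  · exact h.1.symm
  · show p - 1 + 1 = p
    omega

theorem map_degree_map_partVar (lam : TypedPartition k) :
    ((lam.parts : Multiset ℕ).map lam.partVar).map (BVar.degree k) = lam.parts := by
  rw [Multiset.map_map]
  conv_rhs => rw [← Multiset.map_id (lam.parts : Multiset ℕ)]
  exact Multiset.map_congr rfl fun p hp => lam.degree_partVar (lam.pos p hp)

theorem tilde_mem_iff (lam : TypedPartition k) :
    BVar.tilde ∈ (lam.parts : Multiset ℕ).map lam.partVar ↔ lam.type = 2 := by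
  rw [Multiset.mem_map]
  constructor
  · rintro ⟨p, -, hp⟩
    unfold partVar at hp
    split_ifs at hp with h
    exact h.2
  · intro h
    exact ⟨k, lam.type_pos_iff.1 (by omega), by simp [partVar, h]⟩

theorem monomial_injective : Function.Injective (monomial (k := k)) := by
  classical
  intro lam mu h
  have h1 : (lam.parts : Multiset ℕ).map lam.partVar = (mu.parts : Multiset ℕ).map mu.partVar :=
    Multiset.toFinsupp.injective h
  have h2 : lam.parts = mu.parts := by
    have h3 := congrArg (Multiset.map (BVar.degree k)) h1
    rw [map_degree_map_partVar, map_degree_map_partVar, Multiset.coe_eq_coe] at h3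
    exact h3.eq_of_pairwise (fun a b _ _ hab hba => le_antisymm hba hab) lam.sorted mu.sorted
  have h3 : lam.type = 2 ↔ mu.type = 2 := by
    rw [← lam.tilde_mem_iff, ← mu.tilde_mem_iff, h1]
  have h4 : 0 < lam.type ↔ 0 < mu.type := by rw [lam.type_pos_iff, mu.type_pos_iff, h2]
  have h5 := lam.type_le
  have h6 := mu.type_le
  exact TypedPartition.ext h2 (by omega)

theorem monomial_mem_standard (hk : 0 < k) (lam : TypedPartition k) :
    lam.monomial ∈ standardMonomials k := by
  classical
  refine ⟨fun i hi => ?_, ?_⟩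
  · have h1 : Multiset.count (BVar.b i) ((lam.parts : Multiset ℕ).map lam.partVar) ≤
        lam.parts.count (i + 1) := by
      rw [← Multiset.coe_count, Multiset.count_eq_card_filter_eq _ (BVar.b i)]
      conv_rhs => rw [← lam.map_degree_map_partVar, Multiset.count_map]
      refine Multiset.card_le_card (Multiset.monotone_filter_right _ fun v hv => ?_)
      rw [← hv]
      rfl
    have h2 := lam.strict (i + 1) hi
    have h3 : lam.monomial (BVar.b i) =
      Multiset.count (BVar.b i) ((lam.parts : Multiset ℕ).map lam.partVar) := by
      unfold monomial
      rw [Multiset.toFinsupp_apply]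
    rw [h3]
    exact (h1.trans h2).trans_lt (by norm_num)
  · have h3 : ∀ v, v ∉ (lam.parts : Multiset ℕ).map lam.partVar → lam.monomial v = 0 := by
      intro v hv
      unfold monomial
      rw [Multiset.toFinsupp_apply]
      exact Multiset.count_eq_zero.2 hv
    by_cases h : lam.type = 2
    · left
      apply h3
      rw [Multiset.mem_map]
      rintro ⟨p, hp, he⟩
      have := lam.pos p hp
      unfold partVar at he
      split_ifs at he with h4
      have h5 : p - 1 = k - 1 := BVar.b.inj he
      exact h4 ⟨by omega, h⟩
    · right
      exact h3 _ (by rwa [tilde_mem_iff])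

theorem exists_monomial_eq (hk : 0 < k) {m : BVar →₀ ℕ} (hm : m ∈ standardMonomials k) :
    ∃ lam : TypedPartition k, lam.monomial = m := by
  classical
  set s : Multiset ℕ := (Finsupp.toMultiset m).map (BVar.degree k) with hs
  have hmem : ∀ v, v ∈ Finsupp.toMultiset m ↔ m v ≠ 0 := fun v => by
    rw [Finsupp.mem_toMultiset, Finsupp.mem_support_iff]
  have hk' : k ∈ s ↔ m (BVar.b (k - 1)) ≠ 0 ∨ m BVar.tilde ≠ 0 := by
    rw [hs, Multiset.mem_map]
    constructor
    · rintro ⟨_ | i, hv, he⟩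
      · exact Or.inr ((hmem _).1 hv)
      · have he' : i + 1 = k := he
        left
        rw [← he', Nat.add_sub_cancel]
        exact (hmem _).1 hv
    · rintro (h | h)
      · exact ⟨_, (hmem _).2 h, by show k - 1 + 1 = k; omega⟩
      · exact ⟨_, (hmem _).2 h, rfl⟩
  let lam : TypedPartition k :=
    { parts := s.sort (fun a b => b ≤ a)
      sorted := Multiset.pairwise_sort _ _
      pos := by
        intro p hp
        rw [Multiset.mem_sort, hs, Multiset.mem_map] at hp
        obtain ⟨_ | i, -, rfl⟩ := hp
        · exact hk
        · exact Nat.succ_pos i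
      strict := by
        intro p hp
        rw [← Multiset.coe_count, Multiset.sort_eq, hs, Multiset.count_map]
        have hf : Multiset.filter (fun v => p = BVar.degree k v) (Finsupp.toMultiset m) =
            Multiset.filter (fun v => BVar.b (p - 1) = v) (Finsupp.toMultiset m) := by
          refine Multiset.filter_congr fun v _ => ?_
          rcases v with _ | i
          · simp [BVar.degree]; omega
          · simp only [BVar.degree, BVar.b.injEq]; omega
        rw [hf, ← Multiset.count_eq_card_filter_eq, Finsupp.count_toMultiset]
        have := hm.1 (p - 1) (by omega)
        omega
      type := if m BVar.tilde ≠ 0 then 2 else if m (BVar.b (k - 1)) ≠ 0 then 1 else 0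
      type_le := by split_ifs <;> omega
      type_pos_iff := by
        rw [Multiset.mem_sort, hk']
        split_ifs with h1 h2 <;> simp_all }
  refine ⟨lam, ?_⟩
  have h1 : (lam.parts : Multiset ℕ).map lam.partVar = Finsupp.toMultiset m := by
    show Multiset.map lam.partVar ((s.sort (fun a b => b ≤ a) : List ℕ) : Multiset ℕ) = _
    rw [Multiset.sort_eq, hs, Multiset.map_map]
    conv_rhs => rw [← Multiset.map_id (Finsupp.toMultiset m)]
    refine Multiset.map_congr rfl fun v hv => ?_
    have hv' := (hmem v).1 hv
    have ht : lam.type = 2 ↔ m BVar.tilde ≠ 0 := by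
      show (if m BVar.tilde ≠ 0 then 2 else if m (BVar.b (k - 1)) ≠ 0 then 1 else 0) = 2 ↔ _
      split_ifs <;> simp_all
    simp only [Function.comp_apply, id]
    unfold partVar
    rcases v with _ | i
    · rw [if_pos ⟨rfl, ht.2 hv'⟩]
    · rw [if_neg]
      · rfl
      · rintro ⟨he, h2⟩
        rw [ht] at h2
        have he' : i + 1 = k := he
        rcases hm.2 with h3 | h3
        · rw [← he', Nat.add_sub_cancel] at h3
          exact hv' h3
        · exact h2 h3
  unfold monomial
  rw [h1]
  exact Finsupp.toMultiset_toFinsupp m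

theorem monStat_monomial (lam : TypedPartition k) : monStat k lam.monomial = lam.stat := by
  classical
  have h : ∀ t : Multiset BVar, monStat k (Multiset.toFinsupp t) =
      ((t.map (BVar.degree k)).map partStat).sum := by
    intro t
    induction t using Multiset.induction_on with
    | empty => simp
    | cons a t ih =>
      rw [← Multiset.singleton_add, map_add, map_add, ih, Multiset.toFinsupp_singleton,
        monStat_single]
      simp
  have h' := h ((lam.parts : Multiset ℕ).map lam.partVar)
  rw [map_degree_map_partVar, Multiset.map_coe (f := partStat), Multiset.sum_coe] at h'
  rw [stat, ← h']
  unfold monomial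
  congr!

theorem part_eq_getElem (lam : TypedPartition k) (i : Fin lam.length) :
    lam.part i = lam.parts[(i : ℕ)]'i.2 := List.getD_eq_getElem _ _ i.2

theorem part_pos (lam : TypedPartition k) (i : Fin lam.length) : 0 < lam.part i := by
  rw [part_eq_getElem]
  exact lam.pos _ (List.getElem_mem _)

theorem sum_map_parts {M : Type*} [AddCommMonoid M] (lam : TypedPartition k) (f : ℕ → M) :
    (lam.parts.map f).sum = ∑ i : Fin lam.length, f (lam.part i) := by
  have := Fin.sum_univ_fun_getElem lam.parts f
  rw [← this]
  exact Finset.sum_congr rfl fun i _ => (congrArg f (lam.part_eq_getElem i)).symm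

theorem stat_eq_sum (lam : TypedPartition k) :
    lam.stat = ∑ i : Fin lam.length, partStat (lam.part i) := lam.sum_map_parts _

theorem stat_some_zero (lam : TypedPartition k) : lam.stat (some 0) = lam.size := by
  rw [stat_eq_sum, Finset.sum_apply]
  simp only [partStat_some, Nat.sub_zero]
  rw [← lam.sum_map_parts fun p => p]
  simp [size]

theorem stat_none_le (lam : TypedPartition k) : lam.stat none ≤ lam.stat (some 0) ^ 2 := by
  rw [stat_eq_sum]
  exact sum_partStat_none_le _ _

theorem monomial_eq_sum (lam : TypedPartition k) :
    lam.monomial = ∑ i : Fin lam.length, Finsupp.single (lam.partVar (lam.part i)) 1 := by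
  classical
  rw [← lam.sum_map_parts fun p => Finsupp.single (lam.partVar p) 1]
  have h : ∀ l : List ℕ, Multiset.toFinsupp ((l : Multiset ℕ).map lam.partVar) =
      (l.map fun p => Finsupp.single (lam.partVar p) 1).sum := by
    intro l
    induction l with
    | nil => simp
    | cons a l ih =>
      rw [← Multiset.cons_coe, Multiset.map_cons, ← Multiset.singleton_add, map_add, ih,
        Multiset.toFinsupp_singleton]
      simp
  rw [← h]
  unfold monomial
  congr!

theorem numLarge_le_length (lam : TypedPartition k) : lam.numLarge ≤ lam.length :=
  List.countP_le_length

theorem part_eq_zero (lam : TypedPartition k) {j : ℕ} (h : lam.length ≤ j) : lam.part j = 0 :=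
  List.getD_eq_default _ _ h

theorem numLarge_lt_length (hk : 0 < k) (lam : TypedPartition k) (h : 0 < lam.type) :
    lam.numLarge < lam.length := by
  have h1 := (lam.mem_parts_iff hk).1 (lam.type_pos_iff.1 h)
  by_contra hcon
  rw [lam.part_eq_zero (by omega)] at h1
  omega

theorem part_numLarge (hk : 0 < k) (lam : TypedPartition k) (h : 0 < lam.type) :
    lam.part lam.numLarge = k :=
  (lam.mem_parts_iff hk).1 (lam.type_pos_iff.1 h)

theorem stat_some_eq_sum_range (lam : TypedPartition k) (c : ℕ) {N : ℕ} (hN : lam.length ≤ N) :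
    lam.stat (some c) = ∑ j ∈ Finset.range N, (lam.part j - c) := by
  rw [stat_eq_sum, Finset.sum_apply]
  simp only [partStat_some]
  rw [Fin.sum_univ_eq_sum_range (fun j => lam.part j - c)]
  refine Finset.sum_subset (Finset.range_mono hN) fun j _ hj => ?_
  rw [lam.part_eq_zero (by simpa using hj), Nat.zero_sub]

/-- A bound on the statistics with larger sum of squares yields strict dominance.  The sum of the
first `n` parts of `mu` is read off from the truncated differences at `c = mu.part n`. -/
theorem strictlyDominates_or_size_lt {lam mu : TypedPartition k}
    (h : StatLE (lam.stat + statBump) mu.stat) :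
    mu.StrictlyDominates lam ∨ mu.size < lam.size := by
  unfold StatLE at h
  simp only [Pi.add_apply, statBump_some, add_zero, stat_some_zero] at h
  rcases h with h | ⟨h1, h2⟩
  · exact Or.inr h
  refine Or.inl ⟨h1, fun he => ?_, fun n => ?_⟩
  · have := h2 none
    rw [show lam.stat = mu.stat by unfold stat; rw [he]] at this
    simp at this
  · set c := mu.part n with hc
    set N := max n (max lam.length mu.length) with hN
    have h3 := h2 (some c)
    simp only [Pi.add_apply, statBump_some, add_zero] at h3
    rw [lam.stat_some_eq_sum_range c (show lam.length ≤ N by omega),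
      mu.stat_some_eq_sum_range c (show mu.length ≤ N by omega)] at h3
    have h4 : ∑ j ∈ Finset.range n, (lam.part j - c) ≤
        ∑ j ∈ Finset.range N, (lam.part j - c) :=
      Finset.sum_le_sum_of_subset (Finset.range_mono (by omega))
    have h5 : ∑ j ∈ Finset.range n, (mu.part j - c) = ∑ j ∈ Finset.range N, (mu.part j - c) := by
      refine Finset.sum_subset (Finset.range_mono (by omega)) fun j _ hj => ?_
      have := mu.part_antitone (show n ≤ j by simpa using hj)
      omega
    have h6 : ∑ j ∈ Finset.range n, lam.part j ≤
        ∑ j ∈ Finset.range n, ((lam.part j - c) + c) :=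
      Finset.sum_le_sum fun j _ => by omega
    have h7 : ∑ j ∈ Finset.range n, mu.part j =
        ∑ j ∈ Finset.range n, ((mu.part j - c) + c) :=
      Finset.sum_congr rfl fun j hj => by
        have := mu.part_antitone (show j ≤ n by have := Finset.mem_range.1 hj; omega)
        omega
    rw [Finset.sum_add_distrib] at h6 h7
    omega

end TypedPartition

/-! ### The monomials `b_λ` -/

section BMonomials

variable {k : ℕ}

/-- The factor of `b_λ` at position `i`, with integral coefficients. -/
noncomputable def bFactor (lam : TypedPartition k) (i : ℕ) : MvPolynomial BVar ℤ :=
  if 0 < lam.type ∧ i = lam.numLarge then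
    if lam.type = 1 then bPoly ℤ k else bTilde ℤ
  else if i < lam.numLarge then bPoly ℤ (lam.part i) else cPoly ℤ k (lam.part i)

/-- The monomial `b_λ` with integral coefficients. -/
noncomputable def bMonomialInt (lam : TypedPartition k) : MvPolynomial BVar ℤ :=
  ∏ i : Fin lam.length, bFactor lam i

theorem map_bPoly {A B : Type} [CommRing A] [CommRing B] (f : A →+* B) (p : ℤ) :
    MvPolynomial.map f (bPoly A p) = bPoly B p := by
  rcases p with (_ | i) | i <;> simp [bPoly]

theorem map_bTilde {A B : Type} [CommRing A] [CommRing B] (f : A →+* B) :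
    MvPolynomial.map f (bTilde A) = bTilde B := by
  simp [bTilde]

theorem map_cPoly {A B : Type} [CommRing A] [CommRing B] (f : A →+* B) (p : ℤ) :
    MvPolynomial.map f (cPoly A k p) = cPoly B k p := by
  unfold cPoly
  split_ifs
  · exact map_bPoly f p
  · rw [map_add, map_bPoly, map_bTilde]
  · rw [map_mul, map_bPoly]; simp

theorem half_pow_numLarge (lam : TypedPartition k) :
    (1 / 2 : ℚ) ^ lam.numLarge =
      ∏ i : Fin lam.length, if (i : ℕ) < lam.numLarge then (1 / 2 : ℚ) else 1 := by
  rw [Fin.prod_univ_eq_prod_range (fun i => if i < lam.numLarge then (1 / 2 : ℚ) else 1),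
    Finset.prod_ite, Finset.prod_const_one, mul_one, Finset.prod_const]
  congr 1
  rw [show (Finset.range lam.length).filter (fun i => i < lam.numLarge) =
    Finset.range lam.numLarge by
      ext i
      have := lam.numLarge_le_length
      simp only [Finset.mem_filter, Finset.mem_range]
      omega, Finset.card_range]

theorem isIntegralForm_bMonomialInt (lam : TypedPartition k) :
    IsIntegralForm (bMonomialInt lam) (bMonomial lam) := by
  unfold IsIntegralForm bMonomialInt bMonomial
  rw [half_pow_numLarge, map_prod, ← Finset.prod_smul]
  refine Finset.prod_congr rfl fun i _ => ?_
  unfold bFactor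
  by_cases h1 : 0 < lam.type ∧ (i : ℕ) = lam.numLarge
  · have h2 : ¬ (i : ℕ) < lam.numLarge := by omega
    rw [if_pos h1, if_pos h1, if_neg h2, one_smul]
    split_ifs
    · exact map_bPoly _ _
    · exact map_bTilde _
  · rw [if_neg h1, if_neg h1]
    split_ifs with h2
    · have h3 := (lam.lt_part_iff i).2 h2
      rw [map_bPoly, cPoly, if_neg (by omega), if_neg (by omega), two_mul, ← two_smul ℚ, smul_smul]
      norm_num
    · rw [map_cPoly, one_smul]

/-- In the quotient ring, `b_k b̃_k` is a combination of products with strictly larger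
statistics. -/
theorem mk_mul_tilde_mem_statSpan :
    Ideal.Quotient.mk (idealJ k) (bPoly ℤ k) * Ideal.Quotient.mk (idealJ k) (bTilde ℤ) ∈
      statSpan ℤ k (Ideal.Quotient.mk (idealJ k)) (partStat k + partStat k + statBump) := by
  have h := map_mem_statSpan (RingHom.id ℤ) (Ideal.Quotient.mk (idealJ k))
    (fun a x => by simp) (hasLead_relationTilde (k := k)).2
  rw [RingHom.comp_id, map_sub] at h
  have h0 : Ideal.Quotient.mk (idealJ k) (relationTilde k) = 0 :=
    Ideal.Quotient.eq_zero_iff_mem.2 (Ideal.subset_span (Or.inr rfl))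
  rw [h0, zero_sub, map_mul] at h
  exact neg_mem_iff.1 h

/-- Replacing factors `x i` by `y i` does not change the leading term of a product when each
difference `y i - x i` is negligible after multiplication by another factor. -/
theorem mul_prod_sub_mem_statSpan {R S : Type*} [CommRing R] [CommRing S] [Algebra R S]
    {φ : MvPolynomial BVar ℤ →+* S} {ι : Type*} (s : Finset ι) {τ : Option ℕ → ℕ}
    {σ : ι → Option ℕ → ℕ} {x₀ : S} {x y : ι → S}
    (hx : ∀ i ∈ s, x i ∈ statSpan R k φ (σ i)) (hy : ∀ i ∈ s, y i ∈ statSpan R k φ (σ i))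
    (hxy : ∀ i ∈ s, x₀ * (y i - x i) ∈ statSpan R k φ (τ + σ i + statBump)) :
    x₀ * ∏ i ∈ s, y i - x₀ * ∏ i ∈ s, x i ∈ statSpan R k φ (τ + ∑ i ∈ s, σ i + statBump) := by
  classical
  induction s using Finset.induction_on with
  | empty => simp
  | insert a s ha ih =>
    have h1 := ih (fun i hi => hx i (Finset.mem_insert_of_mem hi))
      (fun i hi => hy i (Finset.mem_insert_of_mem hi))
      (fun i hi => hxy i (Finset.mem_insert_of_mem hi))
    have h2 := mul_mem_statSpan h1 (hx a (Finset.mem_insert_self a s))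
    have h3 := mul_mem_statSpan (hxy a (Finset.mem_insert_self a s))
      (prod_mem_statSpan s fun i hi => hy i (Finset.mem_insert_of_mem hi))
    rw [Finset.prod_insert ha, Finset.prod_insert ha, Finset.sum_insert ha]
    rw [show τ + ∑ i ∈ s, σ i + statBump + σ a = τ + (σ a + ∑ i ∈ s, σ i) + statBump by abel] at h2
    rw [show τ + σ a + statBump + ∑ i ∈ s, σ i = τ + (σ a + ∑ i ∈ s, σ i) + statBump by abel] at h3
    convert add_mem h2 h3 using 1
    ring

theorem bFactor_mem_statSpan {R S : Type*} [CommRing R] [CommRing S] [Algebra R S] (hk : 0 < k)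
    (φ : MvPolynomial BVar ℤ →+* S) (lam : TypedPartition k) (i : ℕ) :
    φ (bFactor lam i) ∈ statSpan R k φ (partStat (lam.part i)) := by
  unfold bFactor
  split_ifs with h1 h2 h3
  · rw [h1.2, lam.part_numLarge hk h1.1]
    exact bPoly_mem_statSpan (φ := φ) (k : ℤ)
  · rw [h1.2, lam.part_numLarge hk h1.1]
    exact bTilde_mem_statSpan
  · exact bPoly_mem_statSpan (φ := φ) (lam.part i : ℤ)
  · exact cPoly_mem_statSpan (φ := φ) (lam.part i : ℤ)

/-- In the quotient ring, `b_λ` agrees with the standard monomial of `λ` up to terms with strictly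
larger statistics: `c_k` may be replaced by `b_k` next to a factor `b_k`, and by `b̃_k` next to a
factor `b̃_k`. -/
theorem mk_bMonomialInt_sub_mem (hk : 0 < k) (lam : TypedPartition k) :
    Ideal.Quotient.mk (idealJ k) (bMonomialInt lam) -
        Ideal.Quotient.mk (idealJ k) (monomial lam.monomial 1) ∈
      statSpan ℤ k (Ideal.Quotient.mk (idealJ k)) (lam.stat + statBump) := by
  classical
  set φ := Ideal.Quotient.mk (idealJ k) with hφ
  set x : Fin lam.length → BRing k := fun i => φ (X (lam.partVar (lam.part i))) with hx
  set y : Fin lam.length → BRing k := fun i => φ (bFactor lam i) with hy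
  have hmon : φ (monomial lam.monomial 1) = ∏ i, x i := by
    rw [lam.monomial_eq_sum, hx, ← map_prod]
    congr 1
    exact monomial_sum_one Finset.univ fun i : Fin lam.length =>
      Finsupp.single (lam.partVar (lam.part i)) 1
  have hb : φ (bMonomialInt lam) = ∏ i, y i := by rw [bMonomialInt, map_prod]
  have hxm : ∀ i : Fin lam.length, x i ∈ statSpan ℤ k φ (partStat (lam.part i)) := fun i => by
    have h := X_mem_statSpan (R := ℤ) (k := k) (φ := φ) (lam.partVar (lam.part i))
    rwa [lam.degree_partVar (lam.part_pos i)] at h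
  have hym : ∀ i : Fin lam.length, y i ∈ statSpan ℤ k φ (partStat (lam.part i)) := fun i =>
    bFactor_mem_statSpan hk φ lam i
  have hbX : ∀ i : Fin lam.length,
      x i = φ (bPoly ℤ (lam.part i)) ∨ (lam.part i = k ∧ 0 < lam.type) := by
    intro i
    by_cases h : lam.part i = k ∧ lam.type = 2
    · exact Or.inr ⟨h.1, by omega⟩
    · left
      simp only [hx, TypedPartition.partVar, if_neg h]
      rw [bPoly_natCast _ (lam.part_pos i)]
  have hne : ∀ i : Fin lam.length, lam.part i ≠ k → y i = x i := by
    intro i hi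
    rw [(hbX i).resolve_right fun h => hi h.1]
    simp only [hy, bFactor]
    rw [if_neg]
    · split_ifs with h2
      · rfl
      · have := mt (lam.lt_part_iff i).1 h2
        rw [cPoly, if_pos (by omega)]
    · rintro ⟨h1, h2⟩
      rw [h2, lam.part_numLarge hk h1] at hi
      exact hi rfl
  rw [hmon, hb, lam.stat_eq_sum]
  rcases Nat.eq_zero_or_pos lam.type with ht | ht
  · have hnk : ∀ i : Fin lam.length, lam.part i ≠ k := fun i hi => by
      have : k ∈ lam.parts := by
        have h := List.getElem_mem (l := lam.parts) i.2
        rwa [← lam.part_eq_getElem i, hi] at h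
      have := lam.type_pos_iff.2 this
      omega
    rw [Finset.prod_congr rfl fun i _ => hne i (hnk i), sub_self]
    exact zero_mem _
  -- the first part `k` carries the factor `b_k` or `b̃_k`
  set L : Fin lam.length := ⟨lam.numLarge, lam.numLarge_lt_length hk ht⟩ with hL
  have hLk : lam.part L = k := lam.part_numLarge hk ht
  have ht' : lam.type = 1 ∨ lam.type = 2 := by have := lam.type_le; omega
  have hxk : ∀ i : Fin lam.length, lam.part i = k →
      x i = if lam.type = 1 then φ (bPoly ℤ k) else φ (bTilde ℤ) := by
    intro i hi
    rcases ht' with h | h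
    · simp only [hx, TypedPartition.partVar, h, hi]
      rw [bPoly_natCast _ hk]
      simp
    · simp [hx, TypedPartition.partVar, h, hi, bTilde]
  have hyL : y L = x L := by
    rw [hxk L hLk]
    simp only [hy, bFactor, hL, ht, true_and, if_true]
    split_ifs <;> rfl
  have hxy : ∀ i ∈ Finset.univ.erase L, x L * (y i - x i) ∈
      statSpan ℤ k φ (partStat (lam.part L) + partStat (lam.part i) + statBump) := by
    intro i hi
    by_cases hik : lam.part i = k
    · have hiL : (i : ℕ) ≠ lam.numLarge := fun h' => (Finset.ne_of_mem_erase hi) (Fin.ext h')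
      have hyk : y i = φ (bPoly ℤ k) + φ (bTilde ℤ) := by
        simp only [hy, bFactor]
        rw [if_neg (fun h' => hiL h'.2), if_neg, hik, cPoly, if_neg (by omega), if_pos rfl, map_add]
        intro h'
        have := (lam.lt_part_iff i).2 h'
        omega
      rw [hyk, hxk i hik, hxk L hLk, hLk, hik]
      have hmul := mk_mul_tilde_mem_statSpan (k := k)
      rcases ht' with h' | h'
      · rw [if_pos h', add_sub_cancel_left]
        exact hmul
      · rw [if_neg (by omega), add_sub_cancel_right, mul_comm]
        exact hmul
    · rw [hne i hik, sub_self, mul_zero]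
      exact zero_mem _
  have h := mul_prod_sub_mem_statSpan (Finset.univ.erase L) (fun i _ => hxm i)
    (fun i _ => hym i) hxy
  rw [← Finset.mul_prod_erase Finset.univ x (Finset.mem_univ L),
    ← Finset.mul_prod_erase Finset.univ y (Finset.mem_univ L),
    ← Finset.add_sum_erase Finset.univ _ (Finset.mem_univ L), hyL]
  exact h

/-- The filtration of the quotient ring is spanned by classes of standard monomials. -/
theorem statSpan_le_span_standard (hk : 0 < k) (σ : Option ℕ → ℕ) :
    statSpan ℤ k (Ideal.Quotient.mk (idealJ k)) σ ≤ Submodule.span ℤ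
      ((fun mu : TypedPartition k => Ideal.Quotient.mk (idealJ k) (monomial mu.monomial 1)) ''
        {mu | StatLE σ mu.stat}) := by
  refine Submodule.span_le.2 ?_
  rintro _ ⟨m, hm, rfl⟩
  refine Submodule.span_mono ?_ (mk_monomial_mem_span_standard hk m)
  rintro _ ⟨n, ⟨hn, hmn⟩, rfl⟩
  obtain ⟨mu, rfl⟩ := TypedPartition.exists_monomial_eq hk hn
  rw [mu.monStat_monomial] at hmn
  exact ⟨mu, StatLE.trans hm hmn, rfl⟩

theorem mk_bMonomialInt_sub_mem_span (hk : 0 < k) (lam : TypedPartition k) :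
    Ideal.Quotient.mk (idealJ k) (bMonomialInt lam) -
        Ideal.Quotient.mk (idealJ k) (monomial lam.monomial 1) ∈ Submodule.span ℤ
      ((fun mu : TypedPartition k => Ideal.Quotient.mk (idealJ k) (monomial mu.monomial 1)) ''
        {mu | StatLE lam.stat mu.stat ∧ statRank mu.stat < statRank lam.stat}) := by
  refine Submodule.span_mono (Set.image_mono ?_)
    (statSpan_le_span_standard hk _ (mk_bMonomialInt_sub_mem hk lam))
  exact fun mu hmu => ⟨(statLE_bump _).trans hmu, statRank_lt mu.stat_none_le hmu⟩

/-- The classes of the monomials `b_λ` form a basis of the quotient ring. -/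
theorem exists_bMonomialBasis (hk : 0 < k) :
    ∃ e : Module.Basis (TypedPartition k) ℤ (BRing k),
      ∀ lam, e lam = Ideal.Quotient.mk (idealJ k) (bMonomialInt lam) := by
  obtain ⟨S, hS⟩ := exists_standardBasis hk
  let E : TypedPartition k ≃ standardMonomials k :=
    Equiv.ofBijective (fun lam => ⟨lam.monomial, lam.monomial_mem_standard hk⟩)
      ⟨fun lam mu h => TypedPartition.monomial_injective (congrArg Subtype.val h), fun m => by
        obtain ⟨lam, hlam⟩ := TypedPartition.exists_monomial_eq hk m.2
        exact ⟨lam, Subtype.ext hlam⟩⟩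
  have hE : ∀ lam, S.reindex E.symm lam =
      Ideal.Quotient.mk (idealJ k) (monomial lam.monomial 1) := fun lam => by
    rw [Module.Basis.reindex_apply, Equiv.symm_symm, hS]
    rfl
  refine exists_basis_of_triangular (S.reindex E.symm) _
    (fun lam => statRank lam.stat) fun lam => ?_
  rw [hE, show (S.reindex E.symm : TypedPartition k → BRing k) = _ from funext hE]
  exact Submodule.span_mono (Set.image_mono fun mu h => h.2) (mk_bMonomialInt_sub_mem_span hk lam)

/-- The filtration of the quotient ring is spanned by classes of monomials `b_λ`. -/
theorem statSpan_le_span_bMonomialInt (hk : 0 < k) (σ : Option ℕ → ℕ) :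
    statSpan ℤ k (Ideal.Quotient.mk (idealJ k)) σ ≤ Submodule.span ℤ
      ((fun mu : TypedPartition k => Ideal.Quotient.mk (idealJ k) (bMonomialInt mu)) ''
        {mu | StatLE σ mu.stat}) := by
  refine (statSpan_le_span_standard hk σ).trans (Submodule.span_le.2 ?_)
  rintro _ ⟨mu, hmu, rfl⟩
  have h := mem_span_of_triangular (R := ℤ)
    (e := fun mu : TypedPartition k => Ideal.Quotient.mk (idealJ k) (monomial mu.monomial 1))
    (fun mu : TypedPartition k => statRank mu.stat) (fun mu nu => StatLE mu.stat nu.stat)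
    (fun _ => StatLE.refl _) (fun _ _ _ => StatLE.trans)
    (fun mu => mk_bMonomialInt_sub_mem_span hk mu) mu
  exact Submodule.span_mono (Set.image_mono fun nu hnu => StatLE.trans hmu hnu) h

end BMonomials

/-! ### Raising operators and the statistics -/

section Raising

variable {k : ℕ} {lam : TypedPartition k}

/-- Pairing the change `R λ - λ` with weights `f`. -/
theorem sum_mul_raised_sub (R : RaisingOp lam.length) (f : Fin lam.length → ℤ) :
    ∑ i, f i * (raised lam R i - lam.part i) =
      ∑ p : RaisingPair lam.length, (f p.1.1 - f p.1.2) * R p := by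
  have e1 : ∀ g : RaisingPair lam.length → Fin lam.length,
      ∑ i, f i * ∑ p : RaisingPair lam.length, (if g p = i then (R p : ℤ) else 0) =
        ∑ p : RaisingPair lam.length, f (g p) * R p := by
    intro g
    simp_rw [Finset.mul_sum]
    rw [Finset.sum_comm]
    refine Finset.sum_congr rfl fun p _ => ?_
    simp
  have e2 : ∀ i, f i * (raised lam R i - lam.part i) =
      f i * (∑ p : RaisingPair lam.length, if p.1.1 = i then (R p : ℤ) else 0) -
        f i * ∑ p : RaisingPair lam.length, if p.1.2 = i then (R p : ℤ) else 0 := fun i => by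
    unfold raised
    ring
  simp_rw [e2]
  rw [Finset.sum_sub_distrib, e1 fun p => p.1.1, e1 fun p => p.1.2, ← Finset.sum_sub_distrib]
  exact Finset.sum_congr rfl fun p _ => by ring

theorem sum_mul_raised_sub_nonneg (R : RaisingOp lam.length) {f : Fin lam.length → ℤ}
    (hf : Antitone f) : 0 ≤ ∑ i, f i * (raised lam R i - lam.part i) := by
  rw [sum_mul_raised_sub]
  refine Finset.sum_nonneg fun p _ => mul_nonneg (sub_nonneg.2 (hf p.2.le)) (by positivity)

/-- A nontrivial raising operator makes the statistics strictly larger: the truncated differences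
and the square are convex, with slopes that decrease along the parts of `λ`. -/
theorem statLE_raised {R : RaisingOp lam.length} (hR : R ≠ 0) (h0 : ∀ i, 0 ≤ raised lam R i) :
    StatLE (lam.stat + statBump) (∑ i, partStat (raised lam R i).toNat) := by
  have hpart : ∀ i j : Fin lam.length, i ≤ j → lam.part j ≤ lam.part i := fun i j hij =>
    lam.part_antitone hij
  rw [lam.stat_eq_sum]
  right
  constructor
  · simp only [Finset.sum_apply, Pi.add_apply, partStat_some, Nat.sub_zero, statBump_some, add_zero]
    have h := sum_mul_raised_sub R fun _ => 1
    simp only [one_mul, sub_self, zero_mul, Finset.sum_const_zero, Finset.sum_sub_distrib] at h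
    zify
    rw [Finset.sum_congr rfl fun i _ => Int.toNat_of_nonneg (h0 i)]
    linarith
  · intro o
    cases o with
    | some c =>
      simp only [Finset.sum_apply, Pi.add_apply, partStat_some, statBump_some, add_zero]
      -- `1` for parts greater than `c`, and `0` otherwise, are slopes of `x ↦ max (x - c) 0`
      have h := sum_mul_raised_sub_nonneg R
        (f := fun i => if c < lam.part i then (1 : ℤ) else 0) (fun i j hij => by
          have := hpart i j hij
          simp only
          split_ifs <;> omega)
      have h2 : ∑ i : Fin lam.length, (((lam.part i - c : ℕ) : ℤ) +
          (if c < lam.part i then (1 : ℤ) else 0) * (raised lam R i - lam.part i)) ≤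
          ∑ i, (((raised lam R i).toNat - c : ℕ) : ℤ) := by
        refine Finset.sum_le_sum fun i _ => ?_
        have := h0 i
        split_ifs <;> omega
      rw [Finset.sum_add_distrib] at h2
      zify
      omega
    | none =>
      simp only [Finset.sum_apply, Pi.add_apply, partStat_none, statBump_none]
      have h := sum_mul_raised_sub_nonneg R (f := fun i => (lam.part i : ℤ))
        (fun i j hij => Int.ofNat_le.2 (hpart i j hij))
      obtain ⟨i₀, hi₀⟩ : ∃ i, raised lam R i ≠ lam.part i := by
        by_contra hcon
        push Not at hcon
        -- a nontrivial operator strictly decreases the moment `∑ i * ν_i`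
        have hm := sum_mul_raised_sub R fun i => -((i : ℕ) : ℤ)
        rw [Finset.sum_eq_zero fun i _ => by rw [hcon i, sub_self, mul_zero]] at hm
        obtain ⟨p, hp⟩ := Function.ne_iff.1 hR
        have hle := Finset.single_le_sum (f := fun p : RaisingPair lam.length =>
          (-((p.1.1 : ℕ) : ℤ) - -((p.1.2 : ℕ) : ℤ)) * R p) (fun q _ => by
            have hq : (q.1.1 : ℕ) < q.1.2 := q.2
            exact mul_nonneg (by omega) (by positivity)) (Finset.mem_univ p)
        have hq : (p.1.1 : ℕ) < p.1.2 := p.2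
        have hp' : 0 < R p := Nat.pos_of_ne_zero hp
        have : 0 < (-((p.1.1 : ℕ) : ℤ) - -((p.1.2 : ℕ) : ℤ)) * R p :=
          mul_pos (by omega) (by exact_mod_cast hp')
        omega
      have h2 : 0 < ∑ i : Fin lam.length, (raised lam R i - lam.part i) ^ 2 :=
        Finset.sum_pos' (fun i _ => sq_nonneg _)
          ⟨i₀, Finset.mem_univ _, by have := sub_ne_zero.2 hi₀; positivity⟩
      have h3 : ∑ i : Fin lam.length, raised lam R i ^ 2 =
          ∑ i : Fin lam.length, (lam.part i : ℤ) ^ 2 +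
          2 * ∑ i : Fin lam.length, (lam.part i : ℤ) * (raised lam R i - lam.part i) +
          ∑ i : Fin lam.length, (raised lam R i - lam.part i) ^ 2 := by
        rw [Finset.mul_sum, ← Finset.sum_add_distrib, ← Finset.sum_add_distrib]
        exact Finset.sum_congr rfl fun i _ => by ring
      zify
      simp only [Int.toNat_of_nonneg (h0 _)]
      omega

/-- The coefficient of one factor of a raising operator in the expansion of `R^λ`. -/
noncomputable def pairCoeff (lam : TypedPartition k) (R : RaisingOp lam.length)
    (p : RaisingPair lam.length) : ℚ :=
  open Classical in
  if R p = 0 then 1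
  else if ((p.1.1 : ℕ), (p.1.2 : ℕ)) ∈ pairSet lam then 2 * (-1) ^ R p
  else if R p = 1 then -1 else 0

/-- The product of the coefficients of the operators `R_{ij}` with given second index `j`. -/
noncomputable def lowerCoeff (lam : TypedPartition k) (R : RaisingOp lam.length)
    (j : Fin lam.length) : ℚ :=
  ∏ p : RaisingPair lam.length, if p.1.2 = j then pairCoeff lam R p else 1

theorem raisingCoeff_eq_prod (R : RaisingOp lam.length) :
    raisingCoeff lam R = ∏ j, lowerCoeff lam R j := by
  unfold lowerCoeff
  rw [Finset.prod_comm]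
  simp only [Finset.prod_ite_eq, Finset.mem_univ, if_true]
  rfl

theorem exists_int_pairCoeff (R : RaisingOp lam.length) (p : RaisingPair lam.length) :
    ∃ n : ℤ, pairCoeff lam R p = n := by
  unfold pairCoeff
  split_ifs
  · exact ⟨1, by simp⟩
  · exact ⟨2 * (-1) ^ R p, by simp⟩
  · exact ⟨-1, by simp⟩
  · exact ⟨0, by simp⟩

theorem exists_int_lowerCoeff (R : RaisingOp lam.length) (j : Fin lam.length) :
    ∃ n : ℤ, lowerCoeff lam R j = n := by
  choose n hn using exists_int_pairCoeff (lam := lam) R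
  refine ⟨∏ p : RaisingPair lam.length, if p.1.2 = j then n p else 1, ?_⟩
  unfold lowerCoeff
  push_cast
  exact Finset.prod_congr rfl fun p _ => by split_ifs <;> simp [hn]

/-- The coefficient is even when some operator with a pair in `C(λ)` lowers the entry. -/
theorem exists_two_mul_lowerCoeff (R : RaisingOp lam.length) (p : RaisingPair lam.length)
    (hp : 0 < R p) (hmem : ((p.1.1 : ℕ), (p.1.2 : ℕ)) ∈ pairSet lam) :
    ∃ n : ℤ, lowerCoeff lam R p.1.2 = 2 * n := by
  classical
  choose n hn using exists_int_pairCoeff (lam := lam) R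
  refine ⟨(-1) ^ R p * ∏ q ∈ Finset.univ.erase p, if q.1.2 = p.1.2 then n q else 1, ?_⟩
  unfold lowerCoeff
  rw [← Finset.mul_prod_erase _ _ (Finset.mem_univ p), if_pos rfl]
  have h1 : pairCoeff lam R p = 2 * (-1) ^ R p := by
    unfold pairCoeff
    rw [if_neg hp.ne', if_pos hmem]
  rw [h1]
  push_cast
  rw [mul_assoc]
  congr 2
  exact Finset.prod_congr rfl fun p _ => by split_ifs <;> simp [hn]

theorem lowerCoeff_eq_one (R : RaisingOp lam.length) (j : Fin lam.length)
    (h : ∀ p : RaisingPair lam.length, p.1.2 = j → R p = 0) : lowerCoeff lam R j = 1 := by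
  unfold lowerCoeff
  refine Finset.prod_eq_one fun p _ => ?_
  split_ifs with hp
  · simp [pairCoeff, h p hp]
  · rfl

/-- An entry that is not lowered does not decrease, and it increases if it is raised. -/
theorem raised_of_not_lowered (R : RaisingOp lam.length) (i : Fin lam.length)
    (h : ∀ p : RaisingPair lam.length, p.1.2 = i → R p = 0) :
    (lam.part i : ℤ) ≤ raised lam R i ∧
      ∀ p : RaisingPair lam.length, p.1.1 = i → 0 < R p → (lam.part i : ℤ) < raised lam R i := by
  have h1 : (∑ p : RaisingPair lam.length, if p.1.2 = i then (R p : ℤ) else 0) = 0 :=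
    Finset.sum_eq_zero fun p _ => by
      split_ifs with hp
      · simp [h p hp]
      · rfl
  have h2 : ∀ p : RaisingPair lam.length, 0 ≤ if p.1.1 = i then (R p : ℤ) else 0 := fun p => by
    split_ifs <;> positivity
  have h3 : raised lam R i =
      lam.part i + ∑ p : RaisingPair lam.length, if p.1.1 = i then (R p : ℤ) else 0 := by
    unfold raised
    rw [h1, sub_zero]
  refine ⟨?_, fun p hp hR => ?_⟩
  · have := Finset.sum_nonneg fun p (_ : p ∈ Finset.univ) => h2 p
    omega
  · have := Finset.single_le_sum (fun p _ => h2 p) (Finset.mem_univ p)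
    rw [if_pos hp] at this
    omega

end Raising

/-! ### The Grassmannian element of a typed partition -/

section Grassmannian

variable {k : ℕ}

theorem grassmannianElement_neg (hk : 0 < k) (lam : TypedPartition k) {i : ℕ}
    (hi : i < lam.numLarge) :
    grassmannianElement lam (k + i) < 0 ∧ beta lam i = (k : ℤ) - lam.part i := by
  have hc := (grassmannianElement_corresponds hk lam).part_eq i
  have hl := (lam.lt_part_iff i).2 hi
  split_ifs at hc with h
  · refine ⟨h, ?_⟩
    rw [beta, if_pos h]
    rw [abs_of_neg h] at hc
    omega
  · have h1 := Finset.card_filter_le (Finset.range k)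
      (fun p => grassmannianElement lam (k + i) < |grassmannianElement lam p|)
    rw [Finset.card_range] at h1
    omega

theorem mem_pairSet_of_lt (hk : 0 < k) (lam : TypedPartition k) {i j : ℕ} (hij : i < j)
    (hj : j < lam.numLarge) : (i, j) ∈ pairSet lam := by
  have h1 := (grassmannianElement_neg hk lam (hij.trans hj)).1
  have h2 := (grassmannianElement_neg hk lam hj).1
  exact ⟨hij, by simp only; omega⟩

/-- When `k` is a part, the entry at the position of the first part `k` is `1` or `-1`, so that it
forms pairs in `C(λ)` with all earlier positions. -/
theorem mem_pairSet_numLarge (hk : 0 < k) (lam : TypedPartition k) (ht : 0 < lam.type) {i : ℕ}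
    (hi : i < lam.numLarge) : (i, lam.numLarge) ∈ pairSet lam := by
  have hcor := grassmannianElement_corresponds hk lam
  have hpart := hcor.part_eq
  have hg := hcor.grassmannian
  have hneg : ∀ j, j < lam.numLarge → grassmannianElement lam (k + j) < 0 := fun j hj =>
    (grassmannianElement_neg hk lam hj).1
  set w := grassmannianElement lam with hw
  have hle2 : ∀ j, j < lam.numLarge → w (k + j) ≤ -2 := by
    intro j hj
    have h1 := hneg j hj
    have h2 := hpart j
    rw [if_pos h1, abs_of_neg h1] at h2
    have := (lam.lt_part_iff j).2 hj
    omega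
  refine ⟨hi, ?_⟩
  show w (k + i) + w (k + lam.numLarge) < 0
  -- otherwise the value `1` is taken neither before this position nor after it
  suffices h : w (k + lam.numLarge) ≤ 1 by
    have := hle2 i hi
    omega
  by_contra hcon
  push Not at hcon
  have h2 := hpart lam.numLarge
  rw [lam.part_numLarge hk ht, if_neg (by omega)] at h2
  have hall : ∀ p, p < k → w (k + lam.numLarge) < |w p| := by
    have h3 : (Finset.range k).filter (fun p => w (k + lam.numLarge) < |w p|) = Finset.range k := by
      refine Finset.eq_of_subset_of_card_le (Finset.filter_subset _ _) ?_
      rw [Finset.card_range]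
      omega
    intro p hp
    have : p ∈ (Finset.range k).filter (fun p => w (k + lam.numLarge) < |w p|) := by
      rw [h3]; exact Finset.mem_range.2 hp
    exact (Finset.mem_filter.1 this).2
  have hmono : StrictMono fun j => w (k + j) := strictMono_nat_of_lt_succ fun j => hg.second_lt j
  obtain ⟨x, -, hx⟩ := hg.bijOn.surjOn (show (1 : ℕ) ∈ {m | 0 < m} from Nat.one_pos)
  have hx' : |w x| = 1 := by
    rw [Int.abs_eq_natAbs]
    exact_mod_cast hx
  rcases lt_or_ge x k with hxk | hxk
  · have := hall x hxk
    omega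
  · obtain ⟨j, rfl⟩ := Nat.exists_eq_add_of_le hxk
    rcases lt_or_ge j lam.numLarge with hj | hj
    · have h4 := hle2 j hj
      rw [abs_of_neg (by omega)] at hx'
      omega
    · have h4 : w (k + lam.numLarge) ≤ w (k + j) := hmono.monotone hj
      rw [abs_of_pos (by omega)] at hx'
      omega

end Grassmannian

/-! ### Integrality of the factors -/

section Factors

/-- `ℤ[b, t]`. -/
abbrev ZBT : Type := MvPolynomial ℕ (MvPolynomial BVar ℤ)

/-- The inclusion of `ℤ[b, t]` into `ℚ[b, t]`. -/
noncomputable def toQBT : ZBT →+* QBT :=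
  MvPolynomial.map (MvPolynomial.map (Int.castRingHom ℚ))

/-- `h^r_j(-t)` with integral coefficients. -/
noncomputable def hNegInt : ℤ → ℕ → ZT
  | Int.ofNat r, j => aeval (fun i : Fin r => -(X (i : ℕ) : ZT)) (hsymm (Fin r) ℤ j)
  | Int.negSucc r, j => aeval (fun i : Fin (r + 1) => -(X (i : ℕ) : ZT)) (esymm (Fin (r + 1)) ℤ j)

theorem toQBT_algebraMap_X (i : ℕ) : toQBT (algebraMap ZT ZBT (X i)) = X i := by
  rw [show (algebraMap ZT ZBT) = MvPolynomial.map (algebraMap ℤ (MvPolynomial BVar ℤ)) from rfl,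
    map_X, toQBT, map_X]

theorem toQBT_algebraMap_aeval {n : ℕ} (p : MvPolynomial (Fin n) ℤ) :
    toQBT (algebraMap ZT ZBT (aeval (fun i : Fin n => -(X (i : ℕ) : ZT)) p)) =
      aeval (fun i : Fin n => -(X (i : ℕ) : QBT)) p := by
  have h := MvPolynomial.map_aeval (fun i : Fin n => -(X (i : ℕ) : ZT))
    (toQBT.comp (algebraMap ZT ZBT)) p
  rw [RingHom.comp_apply] at h
  rw [h, aeval_def, coe_eval₂Hom]
  congr 1
  · exact RingHom.ext_int _ _
  · funext i
    rw [map_neg, RingHom.comp_apply, toQBT_algebraMap_X]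

theorem toQBT_hNegInt (r : ℤ) (j : ℕ) : toQBT (algebraMap ZT ZBT (hNegInt r j)) = hNeg r j := by
  cases r <;> exact toQBT_algebraMap_aeval _

theorem hNeg_eq_zero {r : ℤ} {j : ℕ} (hr : r < 0) (h : -r < j) : hNeg r j = 0 := by
  obtain ⟨n, rfl⟩ := Int.eq_negSucc_of_lt_zero hr
  have hj : n + 1 < j := by rw [Int.negSucc_eq] at h; omega
  show aeval _ (esymm (Fin (n + 1)) ℤ j) = 0
  rw [esymm, Finset.powersetCard_eq_empty.2 (by simpa using hj)]
  simp

theorem hNeg_eq_eNeg {d : ℕ} (hd : 0 < d) (j : ℕ) : hNeg (-(d : ℤ)) j = eNeg d j := by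
  obtain ⟨n, rfl⟩ := Nat.exists_eq_succ_of_ne_zero hd.ne'
  rfl

theorem hNeg_zero (r : ℤ) : hNeg r 0 = 1 := by
  cases r <;> simp [hNeg]

variable (k : ℕ)

/-- `y ∈ ℚ[b, t]` has integral coefficients and is the sum of `x₀ ∈ ℤ[b]`, with statistics at least
`σ`, and of terms of lower degree or with strictly larger statistics. -/
def IsIntegralLead (σ : Option ℕ → ℕ) (x₀ : MvPolynomial BVar ℤ) (y : QBT) : Prop :=
  ∃ Y : ZBT, toQBT Y = y ∧ HasLead ZT k C σ (C x₀) Y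

variable {k}

theorem toQBT_C (x : MvPolynomial BVar ℤ) :
    toQBT (C x) = C (MvPolynomial.map (Int.castRingHom ℚ) x) := by
  simp [toQBT]

theorem ratCast_smul_C (a : ℚ) (x : MvPolynomial BVar ℚ) : a • (C x : QBT) = C (a • x) := by
  simp only [Algebra.smul_def, map_mul]
  rfl

theorem IsIntegralLead.intCast_smul {σ : Option ℕ → ℕ} {x₀ : MvPolynomial BVar ℤ} {y : QBT}
    (h : IsIntegralLead k σ x₀ y) (n : ℤ) : IsIntegralLead k σ (n * x₀) ((n : ℚ) • y) := by
  obtain ⟨Y, hY, h1, h2⟩ := h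
  refine ⟨n * Y, ?_, ?_, ?_⟩
  · rw [map_mul, map_intCast, hY, Int.cast_smul_eq_zsmul, zsmul_eq_mul]
  · rw [map_mul, map_intCast]
    exact intCast_mul_mem_statSpan n h1
  · rw [map_mul, map_intCast, ← mul_sub]
    exact intCast_mul_mem_statSpan n h2

/-- A sum `x₀ + ∑_{j = 1}^n x_j h^r_j(-t)`, where `x_j` has degree `p - j`, is led by `x₀`. -/
theorem isIntegralLead_add_sum (r : ℤ) {p n : ℕ} (hn : n ≤ p) (x : ℕ → MvPolynomial BVar ℤ)
    (hx : ∀ j, j ≤ n → (C (x j) : ZBT) ∈ statSpan ZT k C (partStat (p - j))) :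
    IsIntegralLead k (partStat p) (x 0)
      (C (MvPolynomial.map (Int.castRingHom ℚ) (x 0)) +
        ∑ j ∈ Finset.Icc 1 n, C (MvPolynomial.map (Int.castRingHom ℚ) (x j)) * hNeg r j) := by
  refine ⟨C (x 0) + ∑ j ∈ Finset.Icc 1 n, C (x j) * algebraMap ZT ZBT (hNegInt r j), ?_, ?_, ?_⟩
  · rw [map_add, map_sum, toQBT_C]
    congr 1
    refine Finset.sum_congr rfl fun j _ => ?_
    rw [map_mul, toQBT_hNegInt, toQBT_C]
  · exact hx 0 (Nat.zero_le _)
  · rw [add_sub_cancel_left]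
    refine sum_mem fun j hj => ?_
    rw [Finset.mem_Icc] at hj
    rw [mul_comm, ← Algebra.smul_def]
    refine Submodule.smul_mem _ _ (statSpan_anti (Or.inl ?_) (hx j hj.2))
    simp
    omega

theorem C_cPoly_mem_statSpan (p : ℤ) :
    (C (cPoly ℤ k p) : ZBT) ∈ statSpan ZT k C (partStat p.toNat) :=
  cPoly_mem_statSpan p

theorem C_bPoly_mem_statSpan (p : ℤ) :
    (C (bPoly ℤ p) : ZBT) ∈ statSpan ZT k C (partStat p.toNat) :=
  bPoly_mem_statSpan p

theorem C_bTilde_mem_statSpan :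
    (C (bTilde ℤ) : ZBT) ∈ statSpan ZT k C (partStat k) :=
  bTilde_mem_statSpan

theorem toNat_natCast_sub (p j : ℕ) : ((p : ℤ) - (j : ℤ)).toNat = p - j := by omega

/-- Adding a tail to a term of degree `p` yields an integral element led by this term. -/
theorem isIntegralLead_add_tailSum (r : ℤ) (p : ℕ) {x₀ : MvPolynomial BVar ℤ}
    (hx₀ : (C x₀ : ZBT) ∈ statSpan ZT k C (partStat p)) :
    IsIntegralLead k (partStat p) x₀
      (C (MvPolynomial.map (Int.castRingHom ℚ) x₀) + tailSum k r p) := by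
  have h := isIntegralLead_add_sum (k := k) r (le_refl p)
    (fun j => if j = 0 then x₀ else cPoly ℤ k ((p : ℤ) - j)) (fun j _ => by
      split_ifs with hj
      · subst hj; exact hx₀
      · rw [← toNat_natCast_sub]; exact C_cPoly_mem_statSpan _)
  rw [if_pos rfl] at h
  convert h using 2
  rw [tailSum, Int.toNat_natCast]
  refine Finset.sum_congr rfl fun j hj => ?_
  rw [if_neg (by have := (Finset.mem_Icc.1 hj).1; omega), map_cPoly]

theorem cDouble_eq_add_tailSum (r : ℤ) (p : ℕ) :
    cDouble k r p = C (cPoly ℚ k p) + tailSum k r p := by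
  rw [cDouble, tailSum, show ((p : ℤ) + 1).toNat = p + 1 by omega, Int.toNat_natCast,
    Finset.range_eq_Ico, Finset.sum_eq_sum_Ico_succ_bot (by omega), hNeg_zero]
  simp only [Nat.cast_zero, sub_zero, mul_one, zero_add]
  rfl

theorem isIntegralLead_cDouble (r : ℤ) (p : ℕ) :
    IsIntegralLead k (partStat p) (cPoly ℤ k p) (cDouble k r p) := by
  rw [cDouble_eq_add_tailSum, ← map_cPoly (Int.castRingHom ℚ)]
  exact isIntegralLead_add_tailSum r p (C_cPoly_mem_statSpan p)

theorem isIntegralLead_bDouble (r : ℤ) :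
    IsIntegralLead k (partStat k) (bPoly ℤ k) (bDouble k r) := by
  rw [bDouble, ← map_bPoly (Int.castRingHom ℚ)]
  exact isIntegralLead_add_tailSum r k (C_bPoly_mem_statSpan k)

theorem isIntegralLead_bTildeDouble (r : ℤ) :
    IsIntegralLead k (partStat k) (bTilde ℤ) (bTildeDouble k r) := by
  rw [bTildeDouble, ← map_bTilde (Int.castRingHom ℚ)]
  exact isIntegralLead_add_tailSum r k C_bTilde_mem_statSpan

theorem half_smul_cPoly {p : ℤ} (hp : k < p) : (1 / 2 : ℚ) • cPoly ℚ k p = bPoly ℚ p := by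
  rw [cPoly, if_neg (by omega), if_neg (by omega), two_mul, ← two_smul ℚ, smul_smul]
  norm_num

theorem isIntegralLead_aDouble (r : ℤ) {p : ℕ} (hp : k < p) :
    IsIntegralLead k (partStat p) (bPoly ℤ p) (aDouble k r p) := by
  rw [aDouble, half_smul_cPoly (by exact_mod_cast hp), ← map_bPoly (Int.castRingHom ℚ)]
  exact isIntegralLead_add_tailSum r p (C_bPoly_mem_statSpan p)

theorem isIntegralLead_two_smul_aDouble (r : ℤ) (p : ℕ) :
    IsIntegralLead k (partStat p) (cPoly ℤ k p) ((2 : ℚ) • aDouble k r p) := by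
  obtain ⟨Y, hY, h1, h2⟩ := isIntegralLead_cDouble (k := k) r p
  obtain ⟨Z, hZ, h3, h4⟩ := isIntegralLead_add_tailSum (k := k) r p (x₀ := 0) (by simp)
  rw [map_zero, map_zero, zero_add] at hZ
  refine ⟨Y + Z, ?_, h1, ?_⟩
  · rw [map_add, hY, hZ, cDouble_eq_add_tailSum, aDouble, smul_add, ratCast_smul_C, smul_smul,
      two_smul ℚ (tailSum k r p)]
    norm_num [add_assoc]
  · rw [map_zero, sub_zero] at h4
    rw [add_sub_right_comm]
    exact add_mem h2 h4

/-- The correction term in `ĉ^r_p` has lower degree. -/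
theorem isIntegralLead_cHat (i : ℕ) (r : ℤ) (p : ℕ) :
    IsIntegralLead k (partStat p) (cPoly ℤ k p) (cHat k i r p) := by
  rw [cHat]
  by_cases h : r = k - p ∧ r < 0
  swap
  · rw [if_neg h, add_zero]
    exact isIntegralLead_cDouble r p
  rw [if_pos h]
  obtain ⟨Y, hY, h1, h2⟩ := isIntegralLead_cDouble (k := k) r p
  obtain ⟨h3, h4⟩ := h
  set d := ((p : ℤ) - k).toNat with hd
  have hr : r = -(d : ℤ) := by omega
  set x : MvPolynomial BVar ℤ := 2 * (if Even i then bTilde ℤ else bPoly ℤ k) - cPoly ℤ k k with hx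
  refine ⟨Y + C x * algebraMap ZT ZBT (hNegInt r d), ?_, h1, ?_⟩
  · rw [map_add, hY, map_mul, toQBT_hNegInt, toQBT_C, hr, hNeg_eq_eNeg (by omega), hx, map_sub,
      map_cPoly, map_mul]
    split_ifs
    · rw [map_bTilde, map_ofNat]
    · rw [map_bPoly, map_ofNat]
  · rw [add_sub_right_comm]
    refine add_mem h2 ?_
    rw [mul_comm, ← Algebra.smul_def]
    refine Submodule.smul_mem _ _ (statSpan_anti (τ := partStat k) (Or.inl ?_) ?_)
    · simp
      omega
    · have h5 : (C (if Even i then bTilde ℤ else bPoly ℤ k) : ZBT) ∈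
          statSpan ZT k C (partStat k) := by
        split_ifs
        · exact C_bTilde_mem_statSpan
        · exact C_bPoly_mem_statSpan k
      rw [hx, map_sub, two_mul, map_add]
      exact sub_mem (add_mem h5 h5) (C_cPoly_mem_statSpan k)

/-- For a part `l > k` that was raised to `p > l`, the elements `c_{p-j}` that occur in
`c^{k-l}_p` have degree greater than `k`, so that they are even. -/
theorem isIntegralLead_half_cDouble {l p : ℕ} (hl : k < l) (hp : l < p) :
    IsIntegralLead k (partStat p) (bPoly ℤ p) ((1 / 2 : ℚ) • cDouble k ((k : ℤ) - l) p) := by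
  have h := isIntegralLead_add_sum (k := k) ((k : ℤ) - l) (show l - k ≤ p by omega)
    (fun j => bPoly ℤ ((p : ℤ) - j)) (fun j _ => by
      rw [← toNat_natCast_sub]; exact C_bPoly_mem_statSpan _)
  simp only [Nat.cast_zero, sub_zero] at h
  convert h using 1
  rw [cDouble_eq_add_tailSum, smul_add, map_bPoly, ← half_smul_cPoly (k := k) (by omega), tailSum,
    Int.toNat_natCast]
  have hsub : Finset.Icc 1 (l - k) ⊆ Finset.Icc 1 p := Finset.Icc_subset_Icc le_rfl (by omega)
  rw [← Finset.sum_subset hsub fun j hj hj' => by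
    rw [Finset.mem_Icc] at hj hj'
    rw [hNeg_eq_zero (by omega) (by omega), mul_zero], Finset.smul_sum]
  congr 1
  · rw [ratCast_smul_C]
  · refine Finset.sum_congr rfl fun j hj => ?_
    rw [Finset.mem_Icc] at hj
    rw [map_bPoly, ← half_smul_cPoly (k := k) (by omega), ← ratCast_smul_C, smul_mul_assoc]

/-- For a part `l > k` itself, the only odd contribution to `c^{k-l}_l` is
`c_k e^{l-k}_{l-k}(-t)`, which the correction term in `ĉ^{k-l}_l` makes even. -/
theorem isIntegralLead_half_cHat (i : ℕ) {l : ℕ} (hl : k < l) :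
    IsIntegralLead k (partStat l) (bPoly ℤ l) ((1 / 2 : ℚ) • cHat k i ((k : ℤ) - l) l) := by
  set x : MvPolynomial BVar ℤ := if Even i then bTilde ℤ else bPoly ℤ k with hx
  have hxk : (C x : ZBT) ∈ statSpan ZT k C (partStat k) := by
    rw [hx]
    split_ifs
    · exact C_bTilde_mem_statSpan
    · exact C_bPoly_mem_statSpan k
  have hmx : MvPolynomial.map (Int.castRingHom ℚ) x = if Even i then bTilde ℚ else bPoly ℚ k := by
    rw [hx]
    split_ifs
    · exact map_bTilde _
    · exact map_bPoly _ _
  have h := isIntegralLead_add_sum (k := k) ((k : ℤ) - l) (show l - k ≤ l by omega)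
    (fun j => if j = l - k then x else bPoly ℤ ((l : ℤ) - j)) (fun j _ => by
      split_ifs with hj
      · rw [hj, show l - (l - k) = k by omega]; exact hxk
      · rw [← toNat_natCast_sub]; exact C_bPoly_mem_statSpan _)
  rw [if_neg (by omega)] at h
  simp only [Nat.cast_zero, sub_zero] at h
  convert h using 1
  have hcorr : (C (2 * (if Even i then bTilde ℚ else bPoly ℚ k) - cPoly ℚ k k) : QBT) *
      eNeg ((l : ℤ) - k).toNat ((l : ℤ) - k).toNat = ∑ j ∈ Finset.Icc 1 (l - k),
        if j = l - k then C (2 * MvPolynomial.map (Int.castRingHom ℚ) x - cPoly ℚ k k) *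
          hNeg ((k : ℤ) - l) j else 0 := by
    rw [Finset.sum_ite_eq' (Finset.Icc 1 (l - k)),
      if_pos (Finset.mem_Icc.2 ⟨by omega, le_rfl⟩), hmx,
      show ((l : ℤ) - k).toNat = l - k by omega, show (k : ℤ) - l = -((l - k : ℕ) : ℤ) by omega,
      hNeg_eq_eNeg (by omega)]
  rw [cHat, if_pos ⟨rfl, by omega⟩, hcorr, cDouble_eq_add_tailSum, map_bPoly,
    ← half_smul_cPoly (k := k) (by omega), tailSum, Int.toNat_natCast]
  have hsub : Finset.Icc 1 (l - k) ⊆ Finset.Icc 1 l := Finset.Icc_subset_Icc le_rfl (by omega)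
  rw [← Finset.sum_subset hsub fun j hj hj' => by
    rw [Finset.mem_Icc] at hj hj'
    rw [hNeg_eq_zero (by omega) (by omega), mul_zero], add_assoc, smul_add,
    ← Finset.sum_add_distrib, Finset.smul_sum]
  congr 1
  · rw [ratCast_smul_C]
  · refine Finset.sum_congr rfl fun j hj => ?_
    rw [Finset.mem_Icc] at hj
    split_ifs with hjl
    · rw [show (l : ℤ) - j = k by omega, ← add_mul, ← C_add, add_sub_cancel, ← smul_mul_assoc,
        ratCast_smul_C, two_mul, ← two_smul ℚ (MvPolynomial.map (Int.castRingHom ℚ) x), smul_smul]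
      norm_num
    · rw [add_zero, map_bPoly, ← half_smul_cPoly (k := k) (by omega), ← ratCast_smul_C,
        smul_mul_assoc]

end Factors

/-! ### Integrality and leading term of the double eta polynomials -/

section EtaIntegral

variable {k : ℕ} {lam : TypedPartition k}

/-- The share of a position in the scalar `2 ^ (-ℓ_k(λ))`. -/
noncomputable def halfCoeff (lam : TypedPartition k) (i : ℕ) : ℚ :=
  if i < lam.numLarge then 1 / 2 else 1

/-- `y` has integral coefficients and is led by a polynomial of the size of a part `p`.  For trivial
`R` the leading term is the factor of `b_λ` at position `i`. -/
def FactorIntegral (R : RaisingOp lam.length) (i : Fin lam.length) (p : ℕ) (y : QBT) : Prop :=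
  ∃ x₀, IsIntegralLead k (partStat p) x₀ y ∧ (R = 0 → x₀ = bFactor lam i)

/-- At a position of a part greater than `k`, one factor `2` either comes from the coefficient of an
operator that lowers this entry, or from `ĉ`. -/
theorem factorIntegral_of_lt (hk : 0 < k) (R : RaisingOp lam.length) (i : Fin lam.length)
    (h0 : 0 ≤ raised lam R i) (hi : (i : ℕ) < lam.numLarge) :
    FactorIntegral R i (raised lam R i).toNat
      ((halfCoeff lam i * lowerCoeff lam R i) • starFactor lam R i) := by
  have hl := (lam.lt_part_iff i).2 hi
  have hbeta := (grassmannianElement_neg hk lam hi).2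
  have hstar : starFactor lam R i = cBar lam R i := by rw [starFactor, if_pos (Or.inr hi)]
  have hb : bFactor lam i = bPoly ℤ (lam.part i) := by
    rw [bFactor, if_neg (by omega), if_pos hi]
  obtain ⟨q, hq⟩ := Int.eq_ofNat_of_zero_le h0
  rw [hstar, halfCoeff, if_pos hi, hq, Int.toNat_natCast]
  by_cases hlow : ∃ p : RaisingPair lam.length, p.1.2 = i ∧ 0 < R p
  · obtain ⟨p, rfl, hp⟩ := hlow
    obtain ⟨n, hn⟩ := exists_two_mul_lowerCoeff R p hp (mem_pairSet_of_lt hk lam p.2 hi)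
    have hsupp : inSupp lam R p.1.2 := ⟨p, hp, hi, Or.inr rfl⟩
    rw [cBar, if_pos hsupp, hq, hn, ← mul_assoc, show (1 / 2 : ℚ) * 2 = 1 by norm_num, one_mul]
    refine ⟨_, (isIntegralLead_cDouble _ q).intCast_smul n, fun hR => ?_⟩
    rw [hR] at hp
    exact absurd hp (lt_irrefl _)
  · push Not at hlow
    have hlow' : ∀ p : RaisingPair lam.length, p.1.2 = i → R p = 0 := fun p hp =>
      Nat.le_zero.1 (hlow p hp)
    obtain ⟨hge, hgt⟩ := raised_of_not_lowered R i hlow'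
    rw [lowerCoeff_eq_one R i hlow', mul_one]
    refine ⟨bPoly ℤ q, ?_, fun hR => ?_⟩
    · rw [hq] at hge hgt
      rcases (Int.ofNat_le.1 hge).eq_or_lt with he | hlt
      · have hsupp : ¬ inSupp lam R i := by
          rintro ⟨p, hp, -, h1 | h1⟩
          · have := hgt p h1.symm hp
            omega
          · have := hlow' p h1.symm
            omega
        rw [cBar, if_neg hsupp, hbeta, hq, he]
        rw [he] at hl
        exact isIntegralLead_half_cHat i hl
      · have hhat : cHat k i (beta lam i) (raised lam R i) =
            cDouble k (beta lam i) (raised lam R i) := by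
          rw [cHat, if_neg, add_zero]
          rw [hbeta, hq]
          omega
        have hc : cBar lam R i = cDouble k (beta lam i) (raised lam R i) := by
          rw [cBar, hhat, ite_self]
        rw [hc, hbeta, hq]
        exact isIntegralLead_half_cDouble hl hlt
    · have : raised lam R i = lam.part i := by simp [raised, hR]
      rw [hb, ← this, hq]

/-- At the position of the first part `k`, a factor `2` from the coefficient is needed only if an
operator lowers the entry `k`. -/
theorem factorIntegral_numLarge (hk : 0 < k) (R : RaisingOp lam.length) (i : Fin lam.length)
    (h0 : 0 ≤ raised lam R i) (ht : 0 < lam.type) (hi : (i : ℕ) = lam.numLarge) :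
    FactorIntegral R i (raised lam R i).toNat
      ((halfCoeff lam i * lowerCoeff lam R i) • starFactor lam R i) := by
  have hpk : lam.part i = k := by rw [hi, lam.part_numLarge hk ht]
  have hnot : ¬ (lam.type = 0 ∨ (i : ℕ) < lam.numLarge) := by omega
  obtain ⟨q, hq⟩ := Int.eq_ofNat_of_zero_le h0
  rw [halfCoeff, if_neg (by omega), one_mul, starFactor, if_neg hnot, if_pos hi, hq,
    Int.toNat_natCast]
  by_cases hlow : ∃ p : RaisingPair lam.length, p.1.2 = i ∧ 0 < R p
  · obtain ⟨p, rfl, hp⟩ := hlow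
    have hmem : ((p.1.1 : ℕ), (p.1.2 : ℕ)) ∈ pairSet lam := by
      rw [hi]
      refine mem_pairSet_numLarge hk lam ht ?_
      rw [← hi]
      exact p.2
    obtain ⟨n, hn⟩ := exists_two_mul_lowerCoeff R p hp hmem
    have hinv : involvesM lam R := ⟨p, hp, Or.inr hi⟩
    rw [if_pos hinv, hn, mul_comm, mul_smul]
    refine ⟨_, (isIntegralLead_two_smul_aDouble _ q).intCast_smul n, fun hR => ?_⟩
    rw [hR] at hp
    exact absurd hp (lt_irrefl _)
  · push Not at hlow
    have hlow' : ∀ p : RaisingPair lam.length, p.1.2 = i → R p = 0 := fun p hp =>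
      Nat.le_zero.1 (hlow p hp)
    obtain ⟨hge, hgt⟩ := raised_of_not_lowered R i hlow'
    rw [lowerCoeff_eq_one R i hlow', one_smul]
    by_cases hinv : involvesM lam R
    · rw [if_pos hinv]
      obtain ⟨p, hp, h1⟩ := hinv
      have hp1 : p.1.1 = i := by
        rcases h1 with h1 | h1
        · exact Fin.ext (h1.trans hi.symm)
        · have := hlow' p (Fin.ext (h1.trans hi.symm))
          omega
      have hlt := hgt p hp1 hp
      rw [hq, hpk] at hlt
      refine ⟨_, isIntegralLead_aDouble _ (Int.ofNat_lt.1 hlt), fun hR => ?_⟩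
      rw [hR] at hp
      exact absurd hp (lt_irrefl _)
    · rw [if_neg hinv]
      have hqk : q = k := by
        have h1 : ∀ p : RaisingPair lam.length, p.1.1 = i → R p = 0 := fun p hp => by
          by_contra hcon
          exact hinv ⟨p, Nat.pos_of_ne_zero hcon, Or.inl (by rw [hp, hi])⟩
        have h2 : raised lam R i = lam.part i := by
          unfold raised
          rw [Finset.sum_eq_zero, Finset.sum_eq_zero, add_zero, sub_zero]
          · intro p _
            split_ifs with hp
            · simp [hlow' p hp]
            · rfl
          · intro p _
            split_ifs with hp
            · simp [h1 p hp]
            · rfl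
        rw [hq, hpk] at h2
        exact_mod_cast h2
      have hb : bFactor lam i = if lam.type = 1 then bPoly ℤ k else bTilde ℤ := by
        rw [bFactor, if_pos ⟨ht, hi⟩]
      rw [hqk]
      refine ⟨bFactor lam i, ?_, fun _ => rfl⟩
      rw [hb]
      split_ifs
      · exact isIntegralLead_bDouble _
      · exact isIntegralLead_bTildeDouble _

/-- At all other positions the factors have integral coefficients by definition. -/
theorem factorIntegral_of_not_lt (R : RaisingOp lam.length) (i : Fin lam.length)
    (h0 : 0 ≤ raised lam R i) (hi : ¬ (i : ℕ) < lam.numLarge)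
    (hi' : ¬ (0 < lam.type ∧ (i : ℕ) = lam.numLarge)) :
    FactorIntegral R i (raised lam R i).toNat
      ((halfCoeff lam i * lowerCoeff lam R i) • starFactor lam R i) := by
  obtain ⟨q, hq⟩ := Int.eq_ofNat_of_zero_le h0
  obtain ⟨n, hn⟩ := exists_int_lowerCoeff R i
  have hlead : IsIntegralLead k (partStat q) (cPoly ℤ k q) (starFactor lam R i) := by
    unfold starFactor cBar
    rw [hq]
    split_ifs with h1 h2 h3
    · exact isIntegralLead_cDouble _ q
    · exact isIntegralLead_cHat _ _ q
    all_goals first | exact isIntegralLead_cDouble _ q | exact absurd ⟨by omega, h3⟩ hi'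
  rw [halfCoeff, if_neg hi, one_mul, hn, hq, Int.toNat_natCast]
  refine ⟨_, hlead.intCast_smul n, fun hR => ?_⟩
  have h1 : lowerCoeff lam R i = 1 := lowerCoeff_eq_one R i fun p _ => by rw [hR]; rfl
  have h2 : (n : ℚ) = 1 := hn.symm.trans h1
  have h3 : n = 1 := by exact_mod_cast h2
  have h4 : raised lam R i = lam.part i := by simp [raised, hR]
  rw [h3, Int.cast_one, one_mul, bFactor, if_neg hi', if_neg hi, ← h4, hq]

theorem factorIntegral (hk : 0 < k) (R : RaisingOp lam.length) (i : Fin lam.length)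
    (h0 : 0 ≤ raised lam R i) :
    FactorIntegral R i (raised lam R i).toNat
      ((halfCoeff lam i * lowerCoeff lam R i) • starFactor lam R i) := by
  by_cases hi : (i : ℕ) < lam.numLarge
  · exact factorIntegral_of_lt hk R i h0 hi
  by_cases hi' : 0 < lam.type ∧ (i : ℕ) = lam.numLarge
  · exact factorIntegral_numLarge hk R i h0 hi'.1 hi'.2
  · exact factorIntegral_of_not_lt R i h0 hi hi'

/-- The term of `H_λ(c | t)` for a raising operator `R` has integral coefficients.  It is `b_λ`
up to terms in the next step of the filtration if `R` is trivial, and lies in that step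
otherwise. -/
theorem exists_integral_term (hk : 0 < k) (R : RaisingOp lam.length) :
    ∃ Y : ZBT, toQBT Y =
        ((1 / 2 : ℚ) ^ lam.numLarge) • raisingCoeff lam R • starProduct lam R ∧
      Y - (if R = 0 then C (bMonomialInt lam) else 0) ∈
        statSpan ZT k C (lam.stat + statBump) := by
  by_cases h0 : ∀ i, 0 ≤ raised lam R i
  · choose x₀ hx₀ hxR using fun i => factorIntegral hk R i (h0 i)
    choose Y hY hlead using hx₀
    have hprod := HasLead.prod Finset.univ fun i _ => hlead i
    refine ⟨∏ i, Y i, ?_, ?_⟩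
    · rw [map_prod, Finset.prod_congr rfl fun i _ => hY i, Finset.prod_smul,
        Finset.prod_mul_distrib, ← raisingCoeff_eq_prod, smul_smul, half_pow_numLarge]
      rfl
    · split_ifs with hR
      · have hst : ∑ i, partStat (raised lam R i).toNat = lam.stat := by
          rw [lam.stat_eq_sum]
          refine Finset.sum_congr rfl fun i _ => ?_
          rw [show raised lam R i = lam.part i by simp [raised, hR], Int.toNat_natCast]
        have hb : (C (bMonomialInt lam) : ZBT) = ∏ i, C (x₀ i) := by
          rw [bMonomialInt, map_prod]
          exact Finset.prod_congr rfl fun i _ => by rw [hxR i hR]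
        rw [hb, ← hst]
        exact hprod.2
      · rw [sub_zero]
        exact statSpan_anti (statLE_raised hR h0) hprod.mem
  · push Not at h0
    obtain ⟨i, hi⟩ := h0
    refine ⟨0, ?_, ?_⟩
    · rw [starProduct, Finset.prod_eq_zero (Finset.mem_univ i) (starFactor_eq_zero lam R i hi),
        smul_zero, smul_zero, map_zero]
    · have hR : R ≠ 0 := by
        rintro rfl
        simp [raised] at hi
        omega
      rw [if_neg hR, sub_zero]
      exact zero_mem _

/-- The double eta polynomial has integral coefficients, and it is `b_λ` up to terms that have lower
degree or strictly larger statistics. -/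
theorem exists_integral_doubleEta (hk : 0 < k) (lam : TypedPartition k) :
    ∃ Y : ZBT, IsIntegralFormT Y (doubleEta lam) ∧
      Y - C (bMonomialInt lam) ∈ statSpan ZT k C (lam.stat + statBump) := by
  classical
  choose Y hY hspan using fun R : RaisingOp lam.length => exists_integral_term hk R
  set s : Finset (RaisingOp lam.length) :=
    insert 0 (finite_support_starProduct lam).toFinset with hs
  refine ⟨∑ R ∈ s, Y R, ?_, ?_⟩
  · show toQBT _ = _
    rw [map_sum, doubleEta, finsum_eq_sum_of_support_subset (s := s), Finset.smul_sum]
    · exact Finset.sum_congr rfl fun R _ => hY R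
    · intro R hR
      simp only [hs, Finset.coe_insert, Set.Finite.coe_toFinset]
      exact Or.inr hR
  · have h1 : (C (bMonomialInt lam) : ZBT) =
        ∑ R ∈ s, if R = 0 then C (bMonomialInt lam) else 0 := by
      rw [Finset.sum_ite_eq' s, if_pos (Finset.mem_insert_self _ _)]
    rw [h1, ← Finset.sum_sub_distrib]
    refine sum_mem fun R _ => ?_
    convert hspan R

end EtaIntegral

/-! ### Bases over the polynomial ring in the equivariant parameters -/

section BaseChange

variable {k : ℕ}

theorem exists_baseChangeBasis {ι : Type} (e : Module.Basis ι ℤ (BRing k)) :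
    ∃ e' : Module.Basis ι ZT (BRingT k), ∀ i, e' i = C (e i) := by
  have h : IsBaseChange ZT (IsScalarTower.toAlgHom ℤ (BRing k) (BRingT k)).toLinearMap :=
    (inferInstance : Algebra.IsPushout ℤ ZT (BRing k) (BRingT k)).out
  exact ⟨h.basis e, fun i => h.basis_apply e i⟩

theorem toBRingT_C (x : MvPolynomial BVar ℤ) :
    toBRingT k (C x) = C (Ideal.Quotient.mk (idealJ k) x) := by
  simp [toBRingT]

theorem toBRingT_smul (a : ZT) (x : ZBT) : toBRingT k (a • x) = a • toBRingT k x := by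
  rw [Algebra.smul_def, Algebra.smul_def, map_mul]
  congr 1
  rw [MvPolynomial.algebraMap_def, MvPolynomial.algebraMap_def, toBRingT, MvPolynomial.map_map]
  congr 1

theorem toBRingT_mem_span (hk : 0 < k) {σ : Option ℕ → ℕ} {x : ZBT}
    (hx : x ∈ statSpan ZT k C σ) :
    toBRingT k x ∈ Submodule.span ZT
      ((fun mu : TypedPartition k => toBRingT k (C (bMonomialInt mu))) ''
        {mu | StatLE σ mu.stat}) := by
  induction hx using Submodule.span_induction with
  | mem x hx =>
    obtain ⟨m, hm, rfl⟩ := hx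
    have h := statSpan_le_span_bMonomialInt hk σ (monomial_mem_statSpan (R := ℤ) hm)
    rw [toBRingT_C]
    generalize Ideal.Quotient.mk (idealJ k) (monomial m 1) = z at h ⊢
    induction h using Submodule.span_induction with
    | mem x hx =>
      obtain ⟨mu, hmu, rfl⟩ := hx
      rw [← toBRingT_C]
      exact Submodule.subset_span ⟨mu, hmu, rfl⟩
    | zero => simp
    | add x y _ _ hx hy => rw [map_add]; exact add_mem hx hy
    | smul a x _ hx =>
      have h : (C (a • x) : BRingT k) = (C a : ZT) • (C x : BRingT k) := by
        rw [Algebra.smul_def, MvPolynomial.algebraMap_def, map_C, ← C_mul]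
        exact congrArg C (Algebra.smul_def a x)
      rw [h]
      exact Submodule.smul_mem _ _ hx
  | zero => simp
  | add x y _ _ hx hy => rw [map_add]; exact add_mem hx hy
  | smul a x _ hx => rw [toBRingT_smul]; exact Submodule.smul_mem _ _ hx

/-- A family in `ℤ[b, t]` that is led by the monomials `b_λ` yields a basis. -/
theorem exists_basis_of_lead (hk : 0 < k) (Y : TypedPartition k → ZBT)
    (hY : ∀ lam, Y lam - C (bMonomialInt lam) ∈ statSpan ZT k C (lam.stat + statBump)) :
    ∃ e : Module.Basis (TypedPartition k) ZT (BRingT k), ∀ lam, e lam = toBRingT k (Y lam) := by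
  obtain ⟨e, he⟩ := exists_bMonomialBasis hk
  obtain ⟨e', he'⟩ := exists_baseChangeBasis e
  refine exists_basis_of_triangular (R := ZT) (M := BRingT k) e' (fun lam => toBRingT k (Y lam))
    (fun lam => statRank lam.stat) fun lam => ?_
  have hb : (e' : TypedPartition k → BRingT k) = fun mu => toBRingT k (C (bMonomialInt mu)) :=
    funext fun mu => by rw [he', he, toBRingT_C]
  have h := toBRingT_mem_span hk (hY lam)
  rw [map_sub] at h
  rw [hb]
  exact Submodule.span_mono (Set.image_mono fun mu hmu => statRank_lt mu.stat_none_le hmu) h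

/-- Setting `t = 0` preserves the filtration. -/
theorem C_eval_zero_mem_statSpan {σ : Option ℕ → ℕ} {x : ZBT} (hx : x ∈ statSpan ZT k C σ) :
    (C (MvPolynomial.eval (fun _ => 0) x) : ZBT) ∈ statSpan ZT k C σ := by
  induction hx using Submodule.span_induction with
  | mem x hx =>
    obtain ⟨m, hm, rfl⟩ := hx
    rw [eval_C]
    exact monomial_mem_statSpan hm
  | zero => simp
  | add x y _ _ hx hy => rw [map_add, map_add]; exact add_mem hx hy
  | smul a x _ hx =>
    have h : (C (MvPolynomial.eval (fun _ => 0) (algebraMap ZT ZBT a)) : ZBT) =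
        algebraMap ZT ZBT (C (MvPolynomial.eval (fun _ => 0) a)) := by
      rw [MvPolynomial.algebraMap_def, eval_map, map_C]
      congr 1
      rw [MvPolynomial.eval, coe_eval₂Hom, eval₂_comp_left]
      congr 1
      funext i
      simp
    rw [Algebra.smul_def, map_mul, map_mul, h, ← Algebra.smul_def]
    exact Submodule.smul_mem _ _ hx

end BaseChange

theorem mainTheorem2 (k : ℕ) (hk : 0 < k) :
    ∃ (bInt hInt : TypedPartition k → MvPolynomial BVar ℤ)
      (dInt : TypedPartition k → MvPolynomial ℕ (MvPolynomial BVar ℤ)),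
      -- the three families have integral coefficients
      (∀ lam, IsIntegralForm (bInt lam) (bMonomial lam)) ∧
      (∀ lam, IsIntegralForm (hInt lam) (singleEta lam)) ∧
      (∀ lam, IsIntegralFormT (dInt lam) (doubleEta lam)) ∧
      -- and each of them is a basis of `B^{(k)}[t]` over `ℤ[t]`
      (∃ e : Module.Basis (TypedPartition k) ZT (BRingT k),
        ∀ lam, e lam = toBRingT k (C (bInt lam))) ∧
      (∃ e : Module.Basis (TypedPartition k) ZT (BRingT k),
        ∀ lam, e lam = toBRingT k (C (hInt lam))) ∧
      (∃ e : Module.Basis (TypedPartition k) ZT (BRingT k),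
        ∀ lam, e lam = toBRingT k (dInt lam)) ∧
      -- the unitriangular expansion of the double eta polynomials
      (∀ lam, ∃ a : TypedPartition k →₀ ZT,
        (∀ mu ∈ a.support, mu.StrictlyDominates lam ∨ mu.size < lam.size) ∧
        toBRingT k (dInt lam) =
          toBRingT k (C (bInt lam)) + a.sum fun mu x => x • toBRingT k (C (bInt mu))) := by
  choose dInt hform hlead using exists_integral_doubleEta (k := k) hk
  refine ⟨bMonomialInt, fun lam => MvPolynomial.eval (fun _ => 0) (dInt lam), dInt,
    isIntegralForm_bMonomialInt, fun lam => ?_, hform, ?_, ?_, exists_basis_of_lead hk dInt hlead,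
    fun lam => ?_⟩
  · show MvPolynomial.map _ _ = _
    rw [singleEta, ← hform lam, eval_map, MvPolynomial.eval, coe_eval₂Hom, eval₂_comp_left]
    congr 1
  · exact exists_basis_of_lead hk (fun lam => C (bMonomialInt lam)) fun lam => by simp
  · refine exists_basis_of_lead hk
      (fun lam => C (MvPolynomial.eval (fun _ => 0) (dInt lam))) fun lam => ?_
    have h := C_eval_zero_mem_statSpan (hlead lam)
    rwa [map_sub, map_sub, eval_C] at h
  · have h := toBRingT_mem_span hk (hlead lam)
    rw [Finsupp.mem_span_image_iff_linearCombination] at h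
    obtain ⟨a, ha, he⟩ := h
    refine ⟨a, fun mu hmu => ?_, ?_⟩
    · exact TypedPartition.strictlyDominates_or_size_lt (ha hmu)
    · rw [map_sub, Finsupp.linearCombination_apply] at he
      rw [he, add_sub_cancel]
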